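/- Let $\mathcal H$ be a complex Hilbert space and let $A$ be an unbounded self-adjoint operator in $\mathcal H$ with $A\ge\varepsilon^2 I$ for some $\varepsilon>0$. In the Hilbert space $\mathfrak H=\mathcal H\times\mathcal H$ consider $$\mathcal J=\begin{pmatrix}0&\mathrm iI\\-\mathrm iI&0\end{pmatrix},\qquad \mathcal L=\begin{pmatrix}0&\mathrm iI\\-\mathrm iA&0\end{pmatrix},\quad \mathrm{dom}(\mathcal L)=\mathrm{dom}(A)\times\mathcal H,$$ and the indefinite inner product $[f,g]=\langle\mathcal Jf,g\rangle$. Then: 1. $\mathcal J=\mathcal J^*=\mathcal J^{-1}$, and $\mathcal L$ is $\mathcal J$-self-adjoint (i.e. $\mathcal J\mathcal L$ is self-adjoint) and $\mathcal J$-positive (i.e. $[\mathcal Lf,f]>0$ for all $0\ne f\in\mathrm{dom}(\mathcal L)$). 2. $0\in\rho(A)$, and $T(z):=I-z^2A^{-1}=(A-z^2)A^{-1}$ for all $z\in\mathbb C$. Moreover $$\sigma(\mathcal L)=\{\lambda\in\mathbb R:\ \lambda^2\in\sigma(A)\}\subseteq\mathbb R\setminus(-\varepsilon,\varepsilon).$$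 3. For every $z\in\rho(\mathcal L)$ one has $z^2\in\rho(A)$, the bounded operator $T(z)$ is boundedly invertible, $T(z)^{-1}=A(A-z^2)^{-1}$, and $\|T(z)^{-1}\|\ge1$. 4. $\mathcal L$ fails the linear resolvent growth condition: there is no constant $K>0$ such that $\|(\mathcal L-z)^{-1}\|\le K/|\mathrm{Im}\,z|$ for all $z\in\mathbb C\setminus\mathbb R$. Consequently $\mathcal L$ is not similar to a self-adjoint operator: there are no bounded, boundedly invertible $V$ and self-adjoint $S$ in $\mathfrak H$ with $\mathcal L=V^{-1}SV$. 5. $\infty$ is a singular critical point of $\mathcal L$. That is, for the spectral function $E(\cdot)$ (in the sense of Langer) of the $\mathcal J$-positive operator $\mathcal L$, defined on the bounded intervals with endpoints different from $0$ and on their complements in $\mathbb R\cup\{\infty\}$: for every such set $\Delta$ with $\infty\in\Delta$ the form $[\cdot,\cdot]$ takes both positive and negative values $[f,f]$ on the range of $E(\Delta)$ (so $\infty$ is a critical point), and it is not the case that all the strong limits $\lim_{t\to+\infty}E([a,t])$ ($a>0$) and $\lim_{t\to-\infty}E([t,b])$ ($b<0$) exist. -/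

import Mathlib

open Filter Topology

noncomputable section

section Unbounded

variable {E : Type*} [NormedAddCommGroup E] [NormedSpace ℂ E]

/-- The bounded operator `R` is the resolvent `(T - z)⁻¹` of the partially defined operator `T`:
it maps into `dom T` and is a two-sided inverse of `T - z : dom T → E`. -/
def IsResolventOf (T : E →ₗ.[ℂ] E) (z : ℂ) (R : E →L[ℂ] E) : Prop :=
  (∀ x : E, ∃ h : R x ∈ T.domain, T ⟨R x, h⟩ - z • R x = x) ∧
  ∀ x : T.domain, R (T x - z • (x : E)) = x

/-- The resolvent set `ρ(T)` of a partially defined operator. -/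
def opResolventSet (T : E →ₗ.[ℂ] E) : Set ℂ := {z | ∃ R : E →L[ℂ] E, IsResolventOf T z R}

/-- The spectrum `σ(T)` of a partially defined operator. -/
def opSpectrum (T : E →ₗ.[ℂ] E) : Set ℂ := (opResolventSet T)ᶜ

open scoped Classical in
/-- The resolvent `(T - z)⁻¹`, for `z ∈ ρ(T)` (and `0` for `z ∈ σ(T)`). -/
def opResolvent (T : E →ₗ.[ℂ] E) (z : ℂ) : E →L[ℂ] E :=
  if h : ∃ R : E →L[ℂ] E, IsResolventOf T z R then h.choose else 0

/-- For `z ∈ ρ(T)` the operator `opResolvent T z` is the resolvent. -/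
theorem isResolventOf_opResolvent (T : E →ₗ.[ℂ] E) (z : ℂ) (hz : z ∈ opResolventSet T) :
    IsResolventOf T z (opResolvent T z) := by
  have h : ∃ R : E →L[ℂ] E, IsResolventOf T z R := hz
  rw [opResolvent, dif_pos h]
  exact h.choose_spec

/-- The partially defined operator `T` is bounded (on its domain). -/
def IsBoundedPMap (T : E →ₗ.[ℂ] E) : Prop := ∃ c : ℝ, ∀ x : T.domain, ‖T x‖ ≤ c * ‖(x : E)‖

/-- The part `T|M` of `T` in the subspace `M`, with domain `{x ∈ M ∩ dom T : T x ∈ M}`. -/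
def partIn (T : E →ₗ.[ℂ] E) (M : Submodule ℂ E) : M →ₗ.[ℂ] M where
  domain :=
    { carrier := {x | ∃ h : (x : E) ∈ T.domain, T ⟨x, h⟩ ∈ M}
      zero_mem' := ⟨T.domain.zero_mem, by
        have : (⟨((0 : M) : E), T.domain.zero_mem⟩ : T.domain) = 0 := rfl
        rw [this, T.map_zero]; exact M.zero_mem⟩
      add_mem' := by
        rintro x y ⟨hx, hx'⟩ ⟨hy, hy'⟩
        refine ⟨T.domain.add_mem hx hy, ?_⟩
        have : (⟨((x + y : M) : E), T.domain.add_mem hx hy⟩ : T.domain)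
            = ⟨x, hx⟩ + ⟨y, hy⟩ := rfl
        rw [this, T.map_add]; exact M.add_mem hx' hy'
      smul_mem' := by
        rintro c x ⟨hx, hx'⟩
        refine ⟨T.domain.smul_mem c hx, ?_⟩
        have : (⟨((c • x : M) : E), T.domain.smul_mem c hx⟩ : T.domain) = c • ⟨x, hx⟩ := rfl
        rw [this, T.map_smul]; exact M.smul_mem c hx' }
  toFun :=
    { toFun := fun x => ⟨T ⟨(x : M), x.2.1⟩, x.2.2⟩
      map_add' := fun x y => Subtype.ext (T.map_add ⟨(x : M), x.2.1⟩ ⟨(y : M), y.2.1⟩)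
      map_smul' := fun c x => Subtype.ext (T.map_smul c ⟨(x : M), x.2.1⟩) }

/-- The linear resolvent growth condition: all non-real `z` belong to `ρ(T)`, and
`‖(T - z)⁻¹‖ ≤ K / |Im z|` with a constant `K > 0` independent of `z`. -/
def LinearResolventGrowth (T : E →ₗ.[ℂ] E) : Prop :=
  ∃ K : ℝ, 0 < K ∧ ∀ z : ℂ, z.im ≠ 0 → z ∈ opResolventSet T ∧ ‖opResolvent T z‖ ≤ K / |z.im|

end Unbounded

section Krein

variable {K : Type*} [NormedAddCommGroup K] [InnerProductSpace ℂ K]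

/-- `T` is similar to a self-adjoint operator: there are a bounded, boundedly invertible operator
`V` and a self-adjoint operator `S` with `T = V⁻¹ S V` (including equality of domains). -/
def IsSimilarToSelfAdjoint [CompleteSpace K] (T : K →ₗ.[ℂ] K) : Prop :=
  ∃ (V : K ≃L[ℂ] K) (S : K →ₗ.[ℂ] K), IsSelfAdjoint S ∧
    (∀ x : K, x ∈ T.domain ↔ V x ∈ S.domain) ∧
    ∀ (x : T.domain) (y : S.domain), (y : K) = V x → V (T x) = S y

/-- A fundamental symmetry: `J = J* = J⁻¹`. -/
def IsFundamentalSymmetry [CompleteSpace K] (J : K →L[ℂ] K) : Prop :=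
  IsSelfAdjoint J ∧ ∀ x, J (J x) = x

/-- The indefinite inner product `[x, y] = ⟨J x, y⟩`. -/
def kreinInner (J : K →L[ℂ] K) (x y : K) : ℂ := inner ℂ (J x) y

/-- `T` is `J`-self-adjoint: `J T` is self-adjoint. -/
def IsJSelfAdjoint [CompleteSpace K] (J : K →L[ℂ] K) (T : K →ₗ.[ℂ] K) : Prop :=
  IsSelfAdjoint ((J : K →ₗ[ℂ] K).compPMap T)

/-- `T` is `J`-nonnegative: `[T x, x] ≥ 0` for `x ∈ dom T`. -/
def IsJNonneg (J : K →L[ℂ] K) (T : K →ₗ.[ℂ] K) : Prop :=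
  ∀ x : T.domain, 0 ≤ (kreinInner J (T x) x).re

/-- `T` is `J`-positive: `[T x, x] > 0` for `x ∈ dom T`, `x ≠ 0`. -/
def IsJPositive (J : K →L[ℂ] K) (T : K →ₗ.[ℂ] K) : Prop :=
  ∀ x : T.domain, (x : K) ≠ 0 → 0 < (kreinInner J (T x) x).re

/-- Bounded intervals of the real line (possibly empty or degenerate) whose endpoints are
different from `0`. -/
def IsAdmissibleInterval (I : Set ℝ) : Prop :=
  I.OrdConnected ∧ Bornology.IsBounded I ∧ (0 : ℝ) ∉ frontier I

/-- A subset of `ℝ`, viewed as a subset of the extended line `ℝ ∪ {∞}`. -/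
def toExt (I : Set ℝ) : Set (OnePoint ℝ) := (fun t : ℝ => (t : OnePoint ℝ)) '' I

/-- The domain of the spectral function of a `J`-nonnegative operator: the bounded intervals with
endpoints different from `0`, and their complements in the extended line `ℝ ∪ {∞}`. -/
def IsAdmissibleSet (Δ : Set (OnePoint ℝ)) : Prop :=
  ∃ I : Set ℝ, IsAdmissibleInterval I ∧
    (Δ = toExt I ∨ Δ = (toExt I)ᶜ)

/-- `F` is the spectral function (in the sense of Langer) of the `J`-nonnegative `J`-self-adjoint
operator `T` with nonempty resolvent set. Only the values of `F` on admissible sets matter, and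
these are determined uniquely by the following properties. -/
structure IsSpectralFunction (J : K →L[ℂ] K) (T : K →ₗ.[ℂ] K)
    (F : Set (OnePoint ℝ) → (K →L[ℂ] K)) : Prop where
  empty : F ∅ = 0
  univ : F Set.univ = 1
  inter : ∀ Δ Δ', IsAdmissibleSet Δ → IsAdmissibleSet Δ' → IsAdmissibleSet (Δ ∩ Δ') →
    F (Δ ∩ Δ') = F Δ * F Δ'
  union : ∀ Δ Δ', IsAdmissibleSet Δ → IsAdmissibleSet Δ' → IsAdmissibleSet (Δ ∪ Δ') →
    Disjoint Δ Δ' → F (Δ ∪ Δ') = F Δ + F Δ'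
  /-- every `F Δ` is `J`-self-adjoint -/
  symm : ∀ Δ, IsAdmissibleSet Δ → ∀ x y, kreinInner J (F Δ x) y = kreinInner J x (F Δ y)
  /-- the ranges belonging to subsets of the positive half-line are positive subspaces -/
  pos : ∀ Δ, IsAdmissibleSet Δ → Δ ⊆ toExt (Set.Ioi 0) →
    ∀ x, F Δ x ≠ 0 → 0 < (kreinInner J (F Δ x) (F Δ x)).re
  /-- the ranges belonging to subsets of the negative half-line are negative subspaces -/
  neg : ∀ Δ, IsAdmissibleSet Δ → Δ ⊆ toExt (Set.Iio 0) →
    ∀ x, F Δ x ≠ 0 → (kreinInner J (F Δ x) (F Δ x)).re < 0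
  /-- `F Δ` belongs to the double commutant of the resolvent of `T` -/
  bicommutant : ∀ Δ, IsAdmissibleSet Δ → ∀ B : K →L[ℂ] K,
    (∀ z ∈ opResolventSet T, Commute B (opResolvent T z)) → Commute B (F Δ)
  /-- the spectrum of the restriction of `T` to the range of `F Δ` lies in the closure of `Δ` -/
  spectrum_part : ∀ Δ, IsAdmissibleSet Δ →
    opSpectrum (partIn T (LinearMap.range (F Δ : K →ₗ[ℂ] K))) ⊆
      (fun t : ℝ => (t : ℂ)) '' closure {t : ℝ | (t : OnePoint ℝ) ∈ Δ}
  /-- for bounded `Δ`, the range of `F Δ` lies in `dom T` and `T` is bounded there -/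
  bounded : ∀ I : Set ℝ, IsAdmissibleInterval I →
    ∃ c : ℝ, ∀ x : K, ∃ h : F (toExt I) x ∈ T.domain,
      ‖T ⟨F (toExt I) x, h⟩‖ ≤ c * ‖F (toExt I) x‖
  /-- strong countable additivity away from `0` and `∞`, as continuity at the empty set -/
  continuous : ∀ I : ℕ → Set ℝ, (∀ n, IsAdmissibleInterval (I n)) → Antitone I →
    (⋂ n, I n) = ∅ → (0 : ℝ) ∉ closure (I 0) →
    ∀ x : K, Tendsto (fun n => F (toExt (I n)) x) atTop (𝓝 0)

/-- `∞` is a critical point: on the range of `F Δ` the form `[·,·]` is indefinite, for every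
admissible `Δ` containing `∞`. -/
def IsCriticalAtInfinity (J : K →L[ℂ] K) (F : Set (OnePoint ℝ) → (K →L[ℂ] K)) : Prop :=
  ∀ Δ, IsAdmissibleSet Δ → OnePoint.infty ∈ Δ →
    (∃ x, 0 < (kreinInner J (F Δ x) (F Δ x)).re) ∧
    (∃ x, (kreinInner J (F Δ x) (F Δ x)).re < 0)

/-- The strong limits of `F [a, t]` as `t → ∞` (for `a > 0`) and of `F [t, b]` as `t → -∞`
(for `b < 0`) exist. -/
def HasStrongLimitsAtInfinity (F : Set (OnePoint ℝ) → (K →L[ℂ] K)) : Prop :=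
  (∀ a : ℝ, 0 < a → ∀ x : K, ∃ y : K,
    Tendsto (fun t : ℝ => F (toExt (Set.Icc a t)) x) atTop (𝓝 y)) ∧
  (∀ b : ℝ, b < 0 → ∀ x : K, ∃ y : K,
    Tendsto (fun t : ℝ => F (toExt (Set.Icc t b)) x) atBot (𝓝 y))

/-- `∞` is a singular critical point of the `J`-nonnegative `J`-self-adjoint operator `T` with
nonempty resolvent set: it is a critical point, and the strong limits of the spectral function
at `∞` do not all exist. -/
def HasSingularCriticalPointAtInfinity [CompleteSpace K] (J : K →L[ℂ] K) (T : K →ₗ.[ℂ] K) :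
    Prop :=
  IsFundamentalSymmetry J ∧ IsJSelfAdjoint J T ∧ IsJNonneg J T ∧ (opResolventSet T).Nonempty ∧
  ∃ F : Set (OnePoint ℝ) → (K →L[ℂ] K), IsSpectralFunction J T F ∧
    IsCriticalAtInfinity J F ∧ ¬ HasStrongLimitsAtInfinity F

end Krein

section Block

variable {H : Type*} [NormedAddCommGroup H] [InnerProductSpace ℂ H]

/-- The fundamental symmetry `J (f₁, f₂) = (i f₂, -i f₁)` of the Hilbert space `H × H`. -/
def blockJ (H : Type*) [NormedAddCommGroup H] [InnerProductSpace ℂ H] :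
    WithLp 2 (H × H) →L[ℂ] WithLp 2 (H × H) :=
  ((WithLp.prodContinuousLinearEquiv 2 ℂ H H).symm : H × H →L[ℂ] WithLp 2 (H × H)) ∘L
    ((Complex.I • ContinuousLinearMap.snd ℂ H H).prod
      (-Complex.I • ContinuousLinearMap.fst ℂ H H)) ∘L
    ((WithLp.prodContinuousLinearEquiv 2 ℂ H H) : WithLp 2 (H × H) →L[ℂ] H × H)

/-- The operator `L (f₁, f₂) = (i f₂, -i A f₁)` in `H × H`, with domain `dom A × H`. -/
def blockL (A : H →ₗ.[ℂ] H) : WithLp 2 (H × H) →ₗ.[ℂ] WithLp 2 (H × H) where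
  domain :=
    { carrier := {f | f.fst ∈ A.domain}
      zero_mem' := A.domain.zero_mem
      add_mem' := fun hf hg => A.domain.add_mem hf hg
      smul_mem' := fun c _ hf => A.domain.smul_mem c hf }
  toFun :=
    { toFun := fun f => WithLp.toLp 2
        (Complex.I • (f : WithLp 2 (H × H)).snd,
          -Complex.I • A ⟨(f : WithLp 2 (H × H)).fst, f.2⟩)
      map_add' := fun f g => by
        have h := A.map_add ⟨(f : WithLp 2 (H × H)).fst, f.2⟩ ⟨(g : WithLp 2 (H × H)).fst, g.2⟩
        have h' : A ⟨((f + g : _) : WithLp 2 (H × H)).fst, (f + g).2⟩ =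
          A ⟨(f : WithLp 2 (H × H)).fst, f.2⟩ + A ⟨(g : WithLp 2 (H × H)).fst, g.2⟩ := h
        rw [h', ← WithLp.toLp_add]
        simp [smul_add]
      map_smul' := fun c f => by
        have h := A.map_smul c ⟨(f : WithLp 2 (H × H)).fst, f.2⟩
        have h' : A ⟨((c • f : _) : WithLp 2 (H × H)).fst, (c • f).2⟩ =
          c • A ⟨(f : WithLp 2 (H × H)).fst, f.2⟩ := h
        rw [h', ← WithLp.toLp_smul]
        simp [smul_comm c] }

/-- The bounded operator `T(z) = I - z² A⁻¹` in `H` (for `0 ∈ ρ(A)`). -/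
def schurT (A : H →ₗ.[ℂ] H) (z : ℂ) : H →L[ℂ] H := 1 - z ^ 2 • opResolvent A 0

end Block

end

/-! Write `B` for the inverse of `A`: it is bounded, positive and injective, and since `A` is
unbounded it is not surjective. Everything negative in the theorem comes from this failure of
surjectivity.

The equation `(L - z) f = g` reduces to one for `A - z²`, and the four entries of `(L - z)⁻¹` are
explicit in `R = (A - z²)⁻¹` (`isResolventOf_blockL`); this gives the spectrum of `L`. The lower
left entry is `-i (1 + z² R) = -i T(z)⁻¹`. If `T(z)⁻¹` had norm below 1, then `T(z) (1 - T(z)⁻¹) =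
T(z) - 1 = -z² B` would be invertible (`one_le_norm_inverse`). So `(L - z)⁻¹` has norm at least 1
for every `z` in the resolvent set, which is incompatible with decay like `1 / |Im z|` along the
imaginary axis, and hence with similarity to a self-adjoint operator.

For the point at infinity a spectral function must be constructed. Let `G = L⁻¹`. Then `G² = S := B
⊕ B` is positive although `G` need not be normal. Writing spectral points of `S` as `s⁻²` with `s ≥
ε`, split a function `h` on the line as `h(s) = e(s) + s⁻¹ o(s)` with `e`, `o` even, and set `h(L) =
e(S) + G o(S)` (`lineCalc`). This is multiplicative because `G² = S`, and it makes sense when `e`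
and `o` are bounded on `[ε, ∞)`, which covers indicators of bounded intervals and of their
complements. Langer's spectral function is `E(Δ) = χ_Δ(L)` (`isSpectralFunction`); a Borel
functional calculus for `S` is built first.

If `E` vanished on all bounded intervals beyond some `ρ` on one side, the even parts of their
indicators would show that `S` has no spectral part with `s > ρ`, so `S` would be surjective
(`exists_specFun_ne_zero`). Hence both signs of the form occur near infinity. If `E([ε, t])`
converged strongly, then `G o_t(S)` would converge too, where `o_t(s) = s/2` on `[ε, t]`; one
further application of `G` puts the range of `S^(1/2)` inside that of `G` (`exists_eq_of_tendsto`).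
First components of vectors in the range of `G` lie in the range of `B`, and the swap of coordinates
gives the same for second components. So the range of `S^(1/2)` lies in that of `S`, which forces
`S` to be surjective. -/

open Filter Topology

noncomputable section

set_option linter.unusedSectionVars false

/-! ### Bounded Borel functional calculus extending a star-homomorphism on continuous functions -/

section BorelCalculus

open MeasureTheory ENNReal

variable {X : Type*} [MetricSpace X] [CompactSpace X] [MeasurableSpace X] [BorelSpace X]
variable {E : Type*} [NormedAddCommGroup E] [InnerProductSpace ℂ E] [CompleteSpace E]

/-- The positive functional `f ↦ ⟨φ f x, x⟩` on real continuous functions. -/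
def vectorFunctional (φ : C(X, ℂ) →⋆ₐ[ℂ] (E →L[ℂ] E)) (x : E) :
    CompactlySupportedContinuousMap X ℝ →ₚ[ℝ] ℝ :=
  PositiveLinearMap.mk₀
    { toFun := fun f => (inner ℂ x
        (φ ⟨fun t => (f t : ℂ), Complex.continuous_ofReal.comp f.continuous⟩ x)).re
      map_add' := fun f g => by
        have : (⟨fun t => ((f + g) t : ℂ), Complex.continuous_ofReal.comp (f + g).continuous⟩ :
            C(X, ℂ)) = ⟨fun t => (f t : ℂ), Complex.continuous_ofReal.comp f.continuous⟩ +
            ⟨fun t => (g t : ℂ), Complex.continuous_ofReal.comp g.continuous⟩ := by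
          ext t; simp
        rw [this, map_add]
        simp
      map_smul' := fun c f => by
        have : (⟨fun t => ((c • f) t : ℂ), Complex.continuous_ofReal.comp (c • f).continuous⟩ :
            C(X, ℂ)) = (c : ℂ) •
              ⟨fun t => (f t : ℂ), Complex.continuous_ofReal.comp f.continuous⟩ := by
          ext t; simp
        rw [this, map_smul]
        simp }
    (fun f hf => by
      let g : C(X, ℂ) := ⟨fun t => (√(f t) : ℂ), by
        exact Complex.continuous_ofReal.comp (Real.continuous_sqrt.comp f.continuous)⟩
      have h : (⟨fun t => (f t : ℂ), Complex.continuous_ofReal.comp f.continuous⟩ : C(X, ℂ))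
          = star g * g := by
        ext t
        have h0 : 0 ≤ f t := hf t
        simp only [g, ContinuousMap.coe_mk, ContinuousMap.mul_apply, ContinuousMap.star_apply,
          RCLike.star_def, Complex.conj_ofReal]
        rw [← Complex.ofReal_mul, Real.mul_self_sqrt h0]
      change 0 ≤ (inner ℂ x (φ _ x)).re
      rw [h, map_mul, map_star, ContinuousLinearMap.star_eq_adjoint,
        mul_apply_eq_comp, ContinuousLinearMap.adjoint_inner_right]
      exact inner_self_nonneg (𝕜 := ℂ))

/-- Riesz–Markov for `f ↦ ⟨x, φ f x⟩`, evaluated at `f = |g|²`, where `φ (star g * g)` turns the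
functional into a squared norm. Thus `g ↦ φ g x` is an isometry for the `L²` seminorm and extends by
density. -/
theorem exists_vectorMeasure (φ : C(X, ℂ) →⋆ₐ[ℂ] (E →L[ℂ] E)) (x : E) :
    ∃ μ : Measure X, IsFiniteMeasure μ ∧ ∀ g : C(X, ℂ), ‖φ g x‖ₑ = eLpNorm g 2 μ := by
  refine ⟨RealRMK.rieszMeasure (vectorFunctional φ x), inferInstance, fun g => ?_⟩
  set μ := RealRMK.rieszMeasure (vectorFunctional φ x)
  have hn : ‖φ g x‖ ^ 2 = ∫ t, ‖g t‖ ^ 2 ∂μ := by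
    let f : CompactlySupportedContinuousMap X ℝ :=
      ⟨⟨fun t => ‖g t‖ ^ 2, by fun_prop⟩, HasCompactSupport.of_compactSpace _⟩
    have h1 : ∫ t, ‖g t‖ ^ 2 ∂μ = vectorFunctional φ x f :=
      RealRMK.integral_rieszMeasure (vectorFunctional φ x) f
    have h2 : (⟨fun t => (f t : ℂ), Complex.continuous_ofReal.comp f.continuous⟩ : C(X, ℂ))
        = star g * g := by
      ext t
      simp only [f, ContinuousMap.coe_mk, ContinuousMap.mul_apply, ContinuousMap.star_apply,
        RCLike.star_def, Complex.conj_mul']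
      exact Complex.ofReal_pow _ _
    have h3 : vectorFunctional φ x f = (inner ℂ x (φ (star g * g) x)).re := by
      rw [← h2]; rfl
    rw [h1, h3, map_mul, map_star, ContinuousLinearMap.star_eq_adjoint,
      mul_apply_eq_comp, ContinuousLinearMap.adjoint_inner_right]
    exact (inner_self_eq_norm_sq (𝕜 := ℂ) _).symm
  have hm : MemLp g 2 μ := 
    MemLp.of_bound g.continuous.aestronglyMeasurable ‖g‖ (ae_of_all _ g.norm_coe_le_norm)
  rw [hm.eLpNorm_eq_integral_rpow_norm (by norm_num) (by norm_num), ← ofReal_norm]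
  congr 1
  rw [show (ENNReal.toReal 2) = ((2 : ℕ) : ℝ) by simp]
  simp only [Real.rpow_natCast]
  rw [← hn]
  rw [← Real.rpow_natCast, ← Real.rpow_mul (norm_nonneg _)]
  simp

/-- A measure representing the norms `‖φ g x‖`. -/
def vectorMeasure (φ : C(X, ℂ) →⋆ₐ[ℂ] (E →L[ℂ] E)) (x : E) : Measure X :=
  (exists_vectorMeasure φ x).choose

instance (φ : C(X, ℂ) →⋆ₐ[ℂ] (E →L[ℂ] E)) (x : E) : IsFiniteMeasure (vectorMeasure φ x) :=
  (exists_vectorMeasure φ x).choose_spec.1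

theorem enorm_eq_eLpNorm (φ : C(X, ℂ) →⋆ₐ[ℂ] (E →L[ℂ] E)) (x : E) (g : C(X, ℂ)) :
    ‖φ g x‖ₑ = eLpNorm g 2 (vectorMeasure φ x) :=
  (exists_vectorMeasure φ x).choose_spec.2 g

/-- Bounded measurable functions. -/
def BddMeas (f : X → ℂ) : Prop := Measurable f ∧ ∃ M : ℝ, ∀ t, ‖f t‖ ≤ M

namespace BddMeas

variable {f g : X → ℂ}

theorem add (hf : BddMeas f) (hg : BddMeas g) : BddMeas (f + g) := by
  obtain ⟨hf, M, hM⟩ := hf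
  obtain ⟨hg, N, hN⟩ := hg
  exact ⟨hf.add hg, M + N, fun t => (norm_add_le _ _).trans (add_le_add (hM t) (hN t))⟩

theorem sub (hf : BddMeas f) (hg : BddMeas g) : BddMeas (f - g) := by
  obtain ⟨hf, M, hM⟩ := hf
  obtain ⟨hg, N, hN⟩ := hg
  exact ⟨hf.sub hg, M + N, fun t => (norm_sub_le _ _).trans (add_le_add (hM t) (hN t))⟩

theorem mul (hf : BddMeas f) (hg : BddMeas g) : BddMeas (f * g) := by
  obtain ⟨hf, M, hM⟩ := hf
  obtain ⟨hg, N, hN⟩ := hg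
  refine ⟨hf.mul hg, M * N, fun t => ?_⟩
  simp only [Pi.mul_apply, norm_mul]
  exact mul_le_mul (hM t) (hN t) (norm_nonneg _) ((norm_nonneg _).trans (hM t))

theorem star (hf : BddMeas f) : BddMeas (star f) := by
  obtain ⟨hf, M, hM⟩ := hf
  exact ⟨Complex.continuous_conj.measurable.comp hf, M, fun t => by simpa using hM t⟩

theorem continuousMap (g : C(X, ℂ)) : BddMeas (g : X → ℂ) :=
  ⟨g.continuous.measurable, ‖g‖, g.norm_coe_le_norm⟩

theorem memLp (hf : BddMeas f) (μ : Measure X) [IsFiniteMeasure μ] : MemLp f 2 μ :=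
  let ⟨hf, M, hM⟩ := hf
  MemLp.of_bound hf.aestronglyMeasurable M (ae_of_all _ hM)

theorem exists_approx (hf : BddMeas f) (μ : Measure X) [IsFiniteMeasure μ] :
    ∃ g : ℕ → C(X, ℂ), Tendsto (fun n => eLpNorm (f - ⇑(g n)) 2 μ) atTop (𝓝 0) := by
  have h : ∀ n : ℕ, ∃ g : C(X, ℂ), eLpNorm (f - ⇑g) 2 μ ≤ ((n : ℝ≥0∞) + 1)⁻¹ := fun n => by
    obtain ⟨g, hg, -⟩ := (hf.memLp μ).exists_boundedContinuous_eLpNorm_sub_le (by norm_num)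
      (ε := ((n : ℝ≥0∞) + 1)⁻¹) (by simp)
    exact ⟨g.toContinuousMap, hg⟩
  choose g hg using h
  refine ⟨g, tendsto_of_tendsto_of_tendsto_of_le_of_le tendsto_const_nhds ?_
    (fun _ => zero_le) hg⟩
  have := (tendsto_add_atTop_iff_nat 1).2 ENNReal.tendsto_inv_nat_nhds_zero
  simpa using this

end BddMeas

variable (φ : C(X, ℂ) →⋆ₐ[ℂ] (E →L[ℂ] E))

/-- The isometry makes `φ (g n) x` Cauchy whenever `g n → f` in `L²`. The bound against every
continuous `g` determines `y` and does not mention the chosen sequence. -/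
theorem exists_borelApply {f : X → ℂ} (hf : BddMeas f) (x : E) :
    ∃ y : E, ∀ g : C(X, ℂ), ‖y - φ g x‖ₑ ≤ eLpNorm (f - ⇑g) 2 (vectorMeasure φ x) := by
  set μ := vectorMeasure φ x
  obtain ⟨g, hg⟩ := hf.exists_approx μ
  have key : ∀ u v : C(X, ℂ), edist (φ u x) (φ v x) ≤
      eLpNorm (f - ⇑u) 2 μ + eLpNorm (f - ⇑v) 2 μ := fun u v => by
    rw [edist_eq_enorm_sub, ← sub_apply, ← map_sub, enorm_eq_eLpNorm,
      ContinuousMap.coe_sub, show ⇑u - ⇑v = (f - ⇑v) - (f - ⇑u) by abel, add_comm]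
    exact eLpNorm_sub_le (hf.sub (.continuousMap v)).1.aestronglyMeasurable
      (hf.sub (.continuousMap u)).1.aestronglyMeasurable (by norm_num)
  have hc : CauchySeq fun n => φ (g n) x := by
    rw [EMetric.cauchySeq_iff]
    intro ε hε
    have h2 : (0 : ℝ≥0∞) < ε / 2 := ENNReal.half_pos hε.ne'
    obtain ⟨N, hN⟩ := eventually_atTop.1 (hg.eventually (gt_mem_nhds h2))
    refine ⟨N, fun m hm n hn => (key _ _).trans_lt ?_⟩
    calc _ < ε / 2 + ε / 2 := ENNReal.add_lt_add (hN m hm) (hN n hn)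
      _ = ε := ENNReal.add_halves ε
  obtain ⟨y, hy⟩ := cauchySeq_tendsto_of_complete hc
  refine ⟨y, fun u => ?_⟩
  rw [← edist_eq_enorm_sub]
  have h1 : Tendsto (fun n => edist (φ (g n) x) (φ u x)) atTop (𝓝 (edist y (φ u x))) :=
    hy.edist tendsto_const_nhds
  have h2 : Tendsto (fun n => eLpNorm (f - ⇑(g n)) 2 μ + eLpNorm (f - ⇑u) 2 μ) atTop
      (𝓝 (0 + eLpNorm (f - ⇑u) 2 μ)) := hg.add tendsto_const_nhds
  rw [zero_add] at h2
  exact le_of_tendsto_of_tendsto' h1 h2 fun n => key _ _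

open scoped Classical in
/-- The value at `x` of the operator `φ f`, for a bounded measurable function `f`. -/
def borelApply (f : X → ℂ) (x : E) : E :=
  if hf : BddMeas f then (exists_borelApply φ hf x).choose else 0

theorem enorm_borelApply_sub_le {f : X → ℂ} (hf : BddMeas f) (x : E) (g : C(X, ℂ)) :
    ‖borelApply φ f x - φ g x‖ₑ ≤ eLpNorm (f - ⇑g) 2 (vectorMeasure φ x) := by
  rw [borelApply, dif_pos hf]
  exact (exists_borelApply φ hf x).choose_spec g

theorem tendsto_borelApply {f : X → ℂ} (hf : BddMeas f) (x : E) {g : ℕ → C(X, ℂ)}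
    (hg : Tendsto (fun n => eLpNorm (f - ⇑(g n)) 2 (vectorMeasure φ x)) atTop (𝓝 0)) :
    Tendsto (fun n => φ (g n) x) atTop (𝓝 (borelApply φ f x)) := by
  rw [tendsto_iff_edist_tendsto_0]
  refine tendsto_of_tendsto_of_tendsto_of_le_of_le tendsto_const_nhds hg
    (fun _ => zero_le) fun n => ?_
  simp only
  rw [edist_comm, edist_eq_enorm_sub]
  exact enorm_borelApply_sub_le φ hf x _

theorem borelApply_unique {f : X → ℂ} (hf : BddMeas f) (x : E) {g : ℕ → C(X, ℂ)} {y : E}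
    (hg : Tendsto (fun n => eLpNorm (f - ⇑(g n)) 2 (vectorMeasure φ x)) atTop (𝓝 0))
    (hy : Tendsto (fun n => φ (g n) x) atTop (𝓝 y)) : borelApply φ f x = y :=
  tendsto_nhds_unique (tendsto_borelApply φ hf x hg) hy

/-- Simultaneous approximation for three vectors. -/
theorem exists_approx_three {f : X → ℂ} (hf : BddMeas f) (x y z : E) :
    ∃ g : ℕ → C(X, ℂ),
      Tendsto (fun n => eLpNorm (f - ⇑(g n)) 2 (vectorMeasure φ x)) atTop (𝓝 0) ∧
      Tendsto (fun n => eLpNorm (f - ⇑(g n)) 2 (vectorMeasure φ y)) atTop (𝓝 0) ∧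
      Tendsto (fun n => eLpNorm (f - ⇑(g n)) 2 (vectorMeasure φ z)) atTop (𝓝 0) := by
  -- The sum of the three measures dominates each of them, so one approximation serves all three.
  obtain ⟨g, hg⟩ := hf.exists_approx (vectorMeasure φ x + vectorMeasure φ y + vectorMeasure φ z)
  have key : ∀ ν : Measure X,
      ν ≤ vectorMeasure φ x + vectorMeasure φ y + vectorMeasure φ z →
      Tendsto (fun n => eLpNorm (f - ⇑(g n)) 2 ν) atTop (𝓝 0) := fun ν hν =>
    tendsto_of_tendsto_of_tendsto_of_le_of_le tendsto_const_nhds hg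
      (fun _ => zero_le) fun n => eLpNorm_mono_measure _ hν
  refine ⟨g, key _ ?_, key _ ?_, key _ ?_⟩
  · rw [add_assoc]; exact Measure.le_add_right le_rfl
  · exact Measure.le_add_right (Measure.le_add_left le_rfl)
  · exact Measure.le_add_left le_rfl

theorem enorm_borelApply_le {f : X → ℂ} (hf : BddMeas f) (x : E) :
    ‖borelApply φ f x‖ₑ ≤ eLpNorm f 2 (vectorMeasure φ x) := by
  have := enorm_borelApply_sub_le φ hf x 0
  simpa using this

theorem norm_borelApply_le {f : X → ℂ} (hf : BddMeas f) {M : ℝ} (hM : ∀ t, ‖f t‖ ≤ M) (x : E) :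
    ‖borelApply φ f x‖ ≤ |M| * ‖x‖ := by
  have h1 : eLpNorm f 2 (vectorMeasure φ x) ≤ 
      eLpNorm (fun _ : X => (M : ℂ)) 2 (vectorMeasure φ x) := by
    refine eLpNorm_mono fun t => (hM t).trans ?_
    simpa using le_abs_self M
  have h2 := enorm_eq_eLpNorm φ x (algebraMap ℂ C(X, ℂ) (M : ℂ))
  have h3 : φ (algebraMap ℂ C(X, ℂ) (M : ℂ)) x = (M : ℂ) • x := by
    rw [AlgHomClass.commutes, ContinuousLinearMap.algebraMap_apply]
  have h4 : ((algebraMap ℂ C(X, ℂ) (M : ℂ) : C(X, ℂ)) : X → ℂ) = fun _ => (M : ℂ) := rfl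
  rw [h4, h3] at h2
  rw [← h2] at h1
  have h5 := (enorm_borelApply_le φ hf x).trans h1
  rw [enorm_le_iff_norm_le, norm_smul] at h5
  simpa using h5

/-- The operator `φ f`, for a bounded measurable function `f`. -/
def borelCalc (f : X → ℂ) : E →L[ℂ] E :=
  LinearMap.mkContinuousOfExistsBound
    { toFun := borelApply φ f
      map_add' := fun x y => by
        by_cases hf : BddMeas f
        · obtain ⟨g, h1, h2, h3⟩ := exists_approx_three φ hf x y (x + y)
          refine borelApply_unique φ hf _ h3 ?_
          simpa using (tendsto_borelApply φ hf x h1).add (tendsto_borelApply φ hf y h2)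
        · simp [borelApply, hf]
      map_smul' := fun c x => by
        by_cases hf : BddMeas f
        · obtain ⟨g, h1, -, h3⟩ := exists_approx_three φ hf x x (c • x)
          refine borelApply_unique φ hf _ h3 ?_
          simpa using (tendsto_borelApply φ hf x h1).const_smul c
        · simp [borelApply, hf] }
    (by
      by_cases hf : BddMeas f
      · obtain ⟨-, M, hM⟩ := id hf
        exact ⟨|M|, norm_borelApply_le φ hf hM⟩
      · exact ⟨0, fun x => by simp [borelApply, hf]⟩)

theorem borelCalc_apply (f : X → ℂ) (x : E) : borelCalc φ f x = borelApply φ f x := rfl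

theorem borelCalc_continuousMap (g : C(X, ℂ)) : borelCalc φ g = φ g := by
  ext x
  exact borelApply_unique φ (.continuousMap g) x (g := fun _ => g) (by simp) tendsto_const_nhds

variable {φ}

theorem borelCalc_add {f g : X → ℂ} (hf : BddMeas f) (hg : BddMeas g) :
    borelCalc φ (f + g) = borelCalc φ f + borelCalc φ g := by
  ext x
  obtain ⟨u, hu⟩ := hf.exists_approx (vectorMeasure φ x)
  obtain ⟨v, hv⟩ := hg.exists_approx (vectorMeasure φ x)
  refine borelApply_unique φ (hf.add hg) x (g := fun n => u n + v n) ?_ ?_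
  · have := hu.add hv
    rw [add_zero] at this
    refine tendsto_of_tendsto_of_tendsto_of_le_of_le tendsto_const_nhds this
      (fun _ => zero_le) fun n => ?_
    simp only [ContinuousMap.coe_add]
    rw [show f + g - (⇑(u n) + ⇑(v n)) = (f - ⇑(u n)) + (g - ⇑(v n)) by abel]
    exact eLpNorm_add_le (hf.sub (.continuousMap _)).1.aestronglyMeasurable
      (hg.sub (.continuousMap _)).1.aestronglyMeasurable (by norm_num)
  · simpa [borelCalc_apply] using
      (tendsto_borelApply φ hf x hu).add (tendsto_borelApply φ hg x hv)

theorem borelCalc_sub {f g : X → ℂ} (hf : BddMeas f) (hg : BddMeas g) :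
    borelCalc φ (f - g) = borelCalc φ f - borelCalc φ g := by
  rw [eq_sub_iff_add_eq, ← borelCalc_add (hf.sub hg) hg, sub_add_cancel]

theorem tendsto_borelCalc_of_eLpNorm {ι : Type*} {l : Filter ι} {f : X → ℂ} {F : ι → X → ℂ}
    (hf : BddMeas f) (hF : ∀ i, BddMeas (F i)) (x : E)
    (h : Tendsto (fun i => eLpNorm (F i - f) 2 (vectorMeasure φ x)) l (𝓝 0)) :
    Tendsto (fun i => borelCalc φ (F i) x) l (𝓝 (borelCalc φ f x)) := by
  rw [tendsto_iff_edist_tendsto_0]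
  refine tendsto_of_tendsto_of_tendsto_of_le_of_le tendsto_const_nhds h
    (fun _ => zero_le) fun n => ?_
  simp only
  rw [edist_eq_enorm_sub, ← sub_apply, ← borelCalc_sub (hF n) hf]
  exact enorm_borelApply_le φ ((hF n).sub hf) x

/-- Pointwise bounded convergence of functions gives strong convergence of operators. -/
theorem tendsto_borelCalc {f : X → ℂ} {F : ℕ → X → ℂ}
    (hf : BddMeas f) (hF : ∀ i, Measurable (F i)) {M : ℝ} (hM : ∀ i t, ‖F i t‖ ≤ M)
    (h : ∀ t, Tendsto (fun i => F i t) atTop (𝓝 (f t))) (x : E) :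
    Tendsto (fun i => borelCalc φ (F i) x) atTop (𝓝 (borelCalc φ f x)) := by
  refine tendsto_borelCalc_of_eLpNorm hf (fun i => ⟨hF i, M, hM i⟩) x ?_
  refine tendsto_Lp_finite_of_tendsto_ae (by norm_num) (by norm_num)
    (fun i => (hF i).aestronglyMeasurable) (hf.memLp _) ?_ (ae_of_all _ h)
  refine unifIntegrable_of (by norm_num) (by norm_num) 
    (fun i => (hF i).aestronglyMeasurable) fun ε hε => ?_
  -- Any level above the common bound makes the truncated tails empty, so uniform integrability is
  -- immediate.
  refine ⟨Real.toNNReal (|M| + 1), fun i => ?_⟩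
  have : {t | Real.toNNReal (|M| + 1) ≤ ‖F i t‖₊} = ∅ := by
    refine Set.eq_empty_of_forall_notMem fun t ht => ?_
    have h1 : |M| + 1 ≤ ‖F i t‖ := (Real.toNNReal_le_iff_le_coe).1 ht
    linarith [hM i t, le_abs_self M]
  rw [this]
  simp

theorem borelCalc_continuousMap_mul (h : C(X, ℂ)) {f : X → ℂ} (hf : BddMeas f) :
    borelCalc φ (⇑h * f) = φ h * borelCalc φ f := by
  ext x
  obtain ⟨u, hu⟩ := hf.exists_approx (vectorMeasure φ x)
  have := tendsto_borelCalc_of_eLpNorm (φ := φ) (((BddMeas.continuousMap h).mul hf)) 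
    (F := fun n => ((h * u n : C(X, ℂ)) : X → ℂ)) (fun i => .continuousMap _) x (l := atTop) ?_
  · refine tendsto_nhds_unique this ?_
    simp only [borelCalc_continuousMap, map_mul, mul_apply_eq_comp]
    exact ((φ h).continuous.tendsto _).comp (tendsto_borelApply φ hf x hu)
  · have h2 : Tendsto (fun n => ENNReal.ofReal ‖h‖ * eLpNorm (f - ⇑(u n)) 2 (vectorMeasure φ x))
        atTop (𝓝 0) := by
      have := ENNReal.Tendsto.const_mul (a := ENNReal.ofReal ‖h‖) hu
        (Or.inr ENNReal.ofReal_ne_top)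
      rwa [mul_zero] at this
    refine tendsto_of_tendsto_of_tendsto_of_le_of_le tendsto_const_nhds h2
      (fun _ => zero_le) fun n => ?_
    simp only
    refine eLpNorm_le_mul_eLpNorm_of_ae_le_mul (ae_of_all _ fun t => ?_) 2
    simp only [Pi.sub_apply, Pi.mul_apply, ContinuousMap.mul_apply]
    rw [← mul_sub, norm_mul, norm_sub_rev]
    exact mul_le_mul_of_nonneg_right (h.norm_coe_le_norm t) (norm_nonneg _)

/-- The case of a continuous left factor is passed to the limit. The approximants of `f` must be
good for two vectors: for `x`, so that `u n * g → f * g`, and for `borelCalc φ g x`, to which the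
limit operator is applied. -/
theorem borelCalc_mul {f g : X → ℂ} (hf : BddMeas f) (hg : BddMeas g) :
    borelCalc φ (f * g) = borelCalc φ f * borelCalc φ g := by
  ext x
  obtain ⟨u, hu, hu', -⟩ := exists_approx_three φ hf x (borelCalc φ g x) x
  obtain ⟨hgm, M, hM⟩ := id hg
  have := tendsto_borelCalc_of_eLpNorm (φ := φ) (hf.mul hg)
    (F := fun n => ⇑(u n) * g) (fun i => (BddMeas.continuousMap _).mul hg) x (l := atTop) ?_
  · refine tendsto_nhds_unique this ?_
    simp only [borelCalc_continuousMap_mul _ hg, mul_apply_eq_comp]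
    exact tendsto_borelApply φ hf _ hu'
  · have h2 : Tendsto (fun n => ENNReal.ofReal M * eLpNorm (f - ⇑(u n)) 2 (vectorMeasure φ x))
        atTop (𝓝 0) := by
      simpa using ENNReal.Tendsto.const_mul hu (Or.inr ENNReal.ofReal_ne_top)
    refine tendsto_of_tendsto_of_tendsto_of_le_of_le tendsto_const_nhds h2
      (fun _ => zero_le) fun n => ?_
    simp only
    refine eLpNorm_le_mul_eLpNorm_of_ae_le_mul (ae_of_all _ fun t => ?_) 2
    simp only [Pi.sub_apply, Pi.mul_apply]
    rw [← sub_mul, norm_mul, norm_sub_rev, mul_comm]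
    exact mul_le_mul_of_nonneg_right (hM t) (norm_nonneg _)

theorem inner_borelCalc_left {f : X → ℂ} (hf : BddMeas f) (x y : E) :
    inner ℂ (borelCalc φ f x) y = inner ℂ x (borelCalc φ (star f) y) := by
  obtain ⟨u, hu, hu', -⟩ := exists_approx_three φ hf x y x
  have h1 := (tendsto_borelApply φ hf x hu).inner (𝕜 := ℂ) (tendsto_const_nhds (x := y))
  have h2 : Tendsto (fun n => φ (star (u n)) y) atTop (𝓝 (borelCalc φ (star f) y)) := by
    refine tendsto_borelApply φ hf.star y ?_
    refine hu'.congr fun n => eLpNorm_congr_norm_ae (ae_of_all _ fun t => ?_)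
    simp only [Pi.sub_apply, Pi.star_apply, ContinuousMap.star_apply, ← star_sub, norm_star]
  refine tendsto_nhds_unique h1 ((tendsto_const_nhds.inner h2).congr fun n => ?_)
  rw [map_star, ContinuousLinearMap.star_eq_adjoint, ContinuousLinearMap.adjoint_inner_right]

/-- Commutation survives strong limits. No condition on `f` is needed, since `borelCalc` is zero
outside the bounded measurable functions. -/
theorem commute_borelCalc {f : X → ℂ} (T : E →L[ℂ] E)
    (hT : ∀ g : C(X, ℂ), Commute T (φ g)) : Commute T (borelCalc φ f) := by
  ext x
  simp only [mul_apply_eq_comp]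
  by_cases hf : BddMeas f
  · obtain ⟨u, hu, hu', -⟩ := exists_approx_three φ hf x (T x) x
    refine tendsto_nhds_unique ((T.continuous.tendsto _).comp (tendsto_borelApply φ hf x hu)) ?_
    refine (tendsto_borelApply φ hf (T x) hu').congr fun n => ?_
    exact (congrArg (fun S : E →L[ℂ] E => S x) (hT (u n)).eq).symm
  · simp [borelCalc_apply, borelApply, hf]

end BorelCalculus

/-! ### Resolvents of a partially defined operator with bounded inverse -/

section Resolvent

variable {E : Type*} [NormedAddCommGroup E] [NormedSpace ℂ E]

theorem IsResolventOf.unique {T : E →ₗ.[ℂ] E} {z : ℂ} {R R' : E →L[ℂ] E}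
    (h : IsResolventOf T z R) (h' : IsResolventOf T z R') : R = R' := by
  ext x
  obtain ⟨hx, hx'⟩ := h.1 x
  have := h'.2 ⟨R x, hx⟩
  rw [hx'] at this
  exact this.symm

theorem IsResolventOf.eq_opResolvent {T : E →ₗ.[ℂ] E} {z : ℂ} {R : E →L[ℂ] E}
    (h : IsResolventOf T z R) : opResolvent T z = R :=
  (isResolventOf_opResolvent T z ⟨R, h⟩).unique h

theorem IsResolventOf.mem_opResolventSet {T : E →ₗ.[ℂ] E} {z : ℂ} {R : E →L[ℂ] E}
    (h : IsResolventOf T z R) : z ∈ opResolventSet T := ⟨R, h⟩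

theorem IsResolventOf.mem_domain {T : E →ₗ.[ℂ] E} {z : ℂ} {R : E →L[ℂ] E}
    (h : IsResolventOf T z R) (x : E) : R x ∈ T.domain := (h.1 x).1

theorem IsResolventOf.apply_apply {T : E →ₗ.[ℂ] E} {z : ℂ} {R : E →L[ℂ] E}
    (h : IsResolventOf T z R) (x : E) (hx : R x ∈ T.domain) : T ⟨R x, hx⟩ = x + z • R x := by
  obtain ⟨_, hx'⟩ := h.1 x
  exact sub_eq_iff_eq_add.1 hx'

section AtZero

variable {T : E →ₗ.[ℂ] E} {G : E →L[ℂ] E} (hG : IsResolventOf T 0 G)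

include hG

theorem IsResolventOf.map_map_inv (x : E) (hx : G x ∈ T.domain) : T ⟨G x, hx⟩ = x := by
  simpa using hG.apply_apply x hx

theorem IsResolventOf.inv_map (x : T.domain) : G (T x) = x := by
  simpa using hG.2 x

theorem IsResolventOf.inv_injective : Function.Injective G := fun x y h => by
  have h1 := hG.map_map_inv x (hG.mem_domain x)
  have h2 := hG.map_map_inv y (hG.mem_domain y)
  rw [← h1, ← h2]
  congr 1
  exact Subtype.ext h

/-- Formally `T - z = (1 - z G) T`, so `1 - z G` has inverse `T (T - z)⁻¹ = 1 + z R`. The two forms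
`R = G + z G R` and `R = G + z R G` come from the two sides of the definition of the resolvent. -/
theorem IsResolventOf.resolvent_identity {z : ℂ} {R : E →L[ℂ] E} (h : IsResolventOf T z R) :
    (1 - z • G) * (1 + z • R) = 1 ∧ (1 + z • R) * (1 - z • G) = 1 := by
  have h1 : R = G + z • (G * R) := by
    ext x
    obtain ⟨hx, hx'⟩ := h.1 x
    have := congrArg G hx'
    rw [map_sub, hG.inv_map, map_smul] at this
    simp only [add_apply, smul_apply, mul_apply_eq_comp]
    rw [← this]
    simp
  have h2 : R = G + z • (R * G) := by
    ext x
    have hx := hG.mem_domain x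
    have := h.2 ⟨G x, hx⟩
    rw [hG.map_map_inv, map_sub, map_smul] at this
    simp only [add_apply, smul_apply, mul_apply_eq_comp]
    exact sub_eq_iff_eq_add.1 this
  constructor
  · have : (1 - z • G) * (1 + z • R) = 1 + z • (R - (G + z • (G * R))) := by
      simp only [sub_mul, mul_add, one_mul, mul_one, smul_mul_assoc, mul_smul_comm, smul_add,
        smul_sub]
      abel
    rw [this, ← h1, sub_self, smul_zero, add_zero]
  · have : (1 + z • R) * (1 - z • G) = 1 + z • (R - (G + z • (R * G))) := by
      simp only [add_mul, mul_sub, one_mul, mul_one, smul_mul_assoc, mul_smul_comm, smul_add,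
        smul_sub]
      abel
    rw [this, ← h2, sub_self, smul_zero, add_zero]

theorem IsResolventOf.isUnit {z : ℂ} {R : E →L[ℂ] E} (h : IsResolventOf T z R) :
    IsUnit (1 - z • G) :=
  ⟨⟨_, _, (hG.resolvent_identity h).1, (hG.resolvent_identity h).2⟩, rfl⟩

theorem IsResolventOf.inverse_eq {z : ℂ} {R : E →L[ℂ] E} (h : IsResolventOf T z R) :
    Ring.inverse (1 - z • G) = 1 + z • R :=
  Ring.inverse_unit ⟨_, _, (hG.resolvent_identity h).1, (hG.resolvent_identity h).2⟩

/-- Converse to `isUnit`: the resolvent is `G (1 - z G)⁻¹`, and the two factors commute. -/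
theorem IsResolventOf.mem_of_isUnit {z : ℂ} (h : IsUnit (1 - z • G)) : z ∈ opResolventSet T := by
  obtain ⟨u, hu⟩ := h
  set U : E →L[ℂ] E := (u⁻¹ : (E →L[ℂ] E)ˣ).1
  have h1 : (1 - z • G) * U = 1 := by rw [← hu]; exact u.mul_inv
  have h2 : U * (1 - z • G) = 1 := by rw [← hu]; exact u.inv_mul
  have hc : Commute G U := by
    have : Commute G (u : E →L[ℂ] E) := by
      rw [hu]
      exact (Commute.one_right G).sub_right ((Commute.refl G).smul_right z)
    exact this.units_inv_right
  refine ⟨G * U, fun x => ⟨hG.mem_domain (U x), ?_⟩, fun x => ?_⟩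
  · have := congrArg (fun S : E →L[ℂ] E => S x) h1
    simp only [mul_apply_eq_comp, sub_apply, smul_apply,
      one_apply_eq_self] at this
    have h3 := hG.map_map_inv (U x) (hG.mem_domain (U x))
    exact (congrArg (· - z • G (U x)) h3).trans this
  · have := congrArg (fun S : E →L[ℂ] E => S x) h2
    simp only [mul_apply_eq_comp, sub_apply, smul_apply, one_apply_eq_self] at this
    rw [hc.eq, mul_apply_eq_comp, map_sub, hG.inv_map, map_smul, this]

end AtZero

end Resolvent

/-! ### Symmetric operators with full range are self-adjoint -/

section Symmetric

variable {K : Type*} [NormedAddCommGroup K] [InnerProductSpace ℂ K] [CompleteSpace K]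

theorem inner_map_of_isSelfAdjoint {A : K →ₗ.[ℂ] K} (hA : IsSelfAdjoint A) (x y : A.domain) :
    inner ℂ (A x) (y : K) = inner ℂ (x : K) (A y) := by
  have h := LinearPMap.adjoint_isFormalAdjoint (T := A) hA.dense_domain
  rw [LinearPMap.isSelfAdjoint_def.1 hA] at h
  exact h x y

/-- Density: if `M x` is orthogonal to the domain, then `x` is orthogonal to the whole range, hence
zero. Maximality: if `y` is in the adjoint domain and `M* y = M x`, then `y - x` is orthogonal to
the range, so `y = x`. -/
theorem isSelfAdjoint_of_surjective {M : K →ₗ.[ℂ] K}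
    (hs : ∀ x y : M.domain, inner ℂ (M x) (y : K) = inner ℂ (x : K) (M y))
    (hM : ∀ y : K, ∃ x : M.domain, M x = y) : IsSelfAdjoint M := by
  have hd : Dense (M.domain : Set K) := by
    rw [Submodule.dense_iff_topologicalClosure_eq_top, Submodule.topologicalClosure_eq_top_iff,
      Submodule.eq_bot_iff]
    intro y hy
    obtain ⟨x, rfl⟩ := hM y
    have hx : (x : K) = 0 := by
      obtain ⟨u, hu⟩ := hM x
      have h1 : inner ℂ (u : K) (M x) = 0 := (Submodule.mem_orthogonal _ _).1 hy u u.2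
      rw [← hs, hu] at h1
      exact inner_self_eq_zero.1 h1
    rw [show x = 0 from Subtype.ext hx, M.map_zero]
  have hle : M ≤ M.adjoint := LinearPMap.IsFormalAdjoint.le_adjoint hd hs
  rw [LinearPMap.isSelfAdjoint_def]
  refine le_antisymm (LinearPMap.le_of_le_graph fun p hp => ?_) hle
  obtain ⟨y, hy1, hy2⟩ := (LinearPMap.mem_graph_iff _).1 hp
  obtain ⟨x, hx⟩ := hM p.2
  have key : ∀ w : K, inner ℂ w ((y : K) - x) = 0 := fun w => by
    obtain ⟨u, rfl⟩ := hM w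
    have h1 := LinearPMap.adjoint_isFormalAdjoint (T := M) hd y u
    rw [hy2, ← hx, hs x u] at h1
    rw [← inner_conj_symm, inner_sub_left, ← h1, sub_self, map_zero]
  have hyx : (y : K) = x := sub_eq_zero.1 (inner_self_eq_zero.1 (key _))
  refine (LinearPMap.mem_graph_iff _).2 ⟨x, ?_, hx⟩
  rw [← hyx, hy1]

end Symmetric

/-! ### The inverse of an unbounded self-adjoint operator bounded below -/

section BoundedBelow

variable {H : Type*} [NormedAddCommGroup H] [InnerProductSpace ℂ H] [CompleteSpace H]
  {A : H →ₗ.[ℂ] H} (hA : IsSelfAdjoint A) {ε : ℝ} (hε : 0 < ε)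
  (hpos : ∀ x : A.domain, ε ^ 2 * ‖(x : H)‖ ^ 2 ≤ (inner ℂ (A x) (x : H)).re)

include hpos in
omit [CompleteSpace H] in
theorem norm_le_norm_map (x : A.domain) : ε ^ 2 * ‖(x : H)‖ ≤ ‖A x‖ := by
  rcases eq_or_ne (x : H) 0 with h | h
  · simp [h]
  · have h1 := (hpos x).trans ((Complex.re_le_norm _).trans (norm_inner_le_norm _ _))
    have h2 : 0 < ‖(x : H)‖ := norm_pos_iff.2 h
    nlinarith

include hA hε hpos

/-- The range is closed by the lower bound and closedness of `A`. A vector orthogonal to the range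
lies in the domain of the adjoint, which is that of `A`, and `A` kills it; the lower bound makes it
zero. -/
theorem surjective_of_boundedBelow (y : H) : ∃ x : A.domain, A x = y := by
  have hε2 : 0 < ε ^ 2 := by positivity
  have hcl : IsClosed (LinearMap.range A.toFun : Set H) := by
    refine isClosed_of_closure_subset fun y hy => ?_
    obtain ⟨u, hu, hy⟩ := mem_closure_iff_seq_limit.1 hy
    choose x hx using hu
    have hx' : ∀ n, A (x n) = u n := hx
    have hc : CauchySeq fun n => (x n : H) := by
      refine Metric.cauchySeq_iff.2 fun δ hδ => ?_
      obtain ⟨N, hN⟩ := Metric.cauchySeq_iff.1 hy.cauchySeq (ε ^ 2 * δ) (by positivity)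
      refine ⟨N, fun m hm n hn => ?_⟩
      have h1 := hN m hm n hn
      have h2 := norm_le_norm_map hpos (x m - x n)
      rw [A.map_sub, hx', hx', ← dist_eq_norm] at h2
      rw [dist_eq_norm]
      exact lt_of_mul_lt_mul_left (h2.trans_lt h1) hε2.le
    obtain ⟨a, ha⟩ := cauchySeq_tendsto_of_complete hc
    have hg : (a, y) ∈ (A.graph : Set (H × H)) := by
      refine (hA.isClosed : IsClosed (A.graph : Set (H × H))).mem_of_tendsto
        (ha.prodMk_nhds hy) (Eventually.of_forall fun n => ?_)
      exact (LinearPMap.mem_graph_iff _).2 ⟨x n, rfl, hx' n⟩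
    obtain ⟨w, -, hw⟩ := (LinearPMap.mem_graph_iff _).1 hg
    exact ⟨w, hw⟩
  have hbot : (LinearMap.range A.toFun)ᗮ = ⊥ := by
    rw [Submodule.eq_bot_iff]
    intro y hy
    have h0 : ∀ x : A.domain, inner ℂ y (A x) = 0 := fun x =>
      (Submodule.mem_orthogonal' _ _).1 hy _ ⟨x, rfl⟩
    have hd : y ∈ A.adjoint.domain :=
      LinearPMap.mem_adjoint_domain_of_exists y ⟨0, fun x => by rw [h0, inner_zero_left]⟩
    rw [LinearPMap.isSelfAdjoint_def.1 hA] at hd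
    have h1 : ∀ x : A.domain, inner ℂ (A ⟨y, hd⟩) (x : H) = 0 := fun x => by
      rw [inner_map_of_isSelfAdjoint hA]
      exact h0 x
    have h2 := hpos ⟨y, hd⟩
    rw [h1 ⟨y, hd⟩] at h2
    have h3 : ‖y‖ ^ 2 ≤ 0 := by
      have : 0 ≤ ‖y‖ ^ 2 := by positivity
      simp only [Complex.zero_re] at h2
      nlinarith
    exact norm_eq_zero.1 (by nlinarith [norm_nonneg y])
  have htop : LinearMap.range A.toFun = ⊤ := by
    rw [← hcl.submodule_topologicalClosure_eq, Submodule.topologicalClosure_eq_top_iff, hbot]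
  obtain ⟨x, hx⟩ := LinearMap.range_eq_top.1 htop y
  exact ⟨x, hx⟩

theorem zero_mem_opResolventSet : (0 : ℂ) ∈ opResolventSet A := by
  have hε2 : 0 < ε ^ 2 := by positivity
  have hbij : Function.Bijective A.toFun := by
    refine ⟨(injective_iff_map_eq_zero _).2 fun x hx => Subtype.ext ?_,
      surjective_of_boundedBelow hA hε hpos⟩
    have h := norm_le_norm_map hpos x
    rw [show A x = 0 from hx, norm_zero] at h
    exact norm_eq_zero.1 (by nlinarith [norm_nonneg (x : H)])
  let e := LinearEquiv.ofBijective A.toFun hbij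
  have he : ∀ y, A (e.symm y) = y := fun y => e.apply_symm_apply y
  let R : H →L[ℂ] H := (A.domain.subtype ∘ₗ e.symm.toLinearMap).mkContinuous (ε ^ 2)⁻¹ (fun y => by
    have h := norm_le_norm_map hpos (e.symm y)
    rw [he] at h
    rw [inv_mul_eq_div, le_div_iff₀ hε2, mul_comm]
    exact h)
  refine ⟨R, fun y => ⟨(e.symm y).2, ?_⟩, fun x => ?_⟩
  · rw [zero_smul, sub_zero]
    exact he y
  · rw [zero_smul, sub_zero]
    exact congrArg Subtype.val (e.symm_apply_apply x)

theorem isResolventOf_zero : IsResolventOf A 0 (opResolvent A 0) :=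
  isResolventOf_opResolvent A 0 (zero_mem_opResolventSet hA hε hpos)

theorem inner_inv_left (x y : H) :
    inner ℂ (opResolvent A 0 x) y = inner ℂ x (opResolvent A 0 y) := by
  have hB := isResolventOf_zero hA hε hpos
  have h := inner_map_of_isSelfAdjoint hA ⟨_, hB.mem_domain x⟩ ⟨_, hB.mem_domain y⟩
  rw [hB.map_map_inv, hB.map_map_inv] at h
  exact h.symm

theorem norm_inv_le : ‖opResolvent A 0‖ ≤ (ε ^ 2)⁻¹ := by
  have hB := isResolventOf_zero hA hε hpos
  refine ContinuousLinearMap.opNorm_le_bound _ (by positivity) fun x => ?_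
  have h := norm_le_norm_map hpos ⟨_, hB.mem_domain x⟩
  rw [hB.map_map_inv] at h
  rw [inv_mul_eq_div, le_div_iff₀ (by positivity), mul_comm]
  exact h

theorem re_inner_inv_nonneg (x : H) : 0 ≤ (inner ℂ (opResolvent A 0 x) x).re := by
  have hB := isResolventOf_zero hA hε hpos
  have h := hpos ⟨_, hB.mem_domain x⟩
  rw [hB.map_map_inv] at h
  rw [inner_inv_left hA hε hpos]
  exact le_trans (by positivity) h

omit hA hε hpos in
/-- The spectrum of a positive operator `S` with `‖S‖ ≤ c` lies in `[0, c]`. -/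
theorem mem_spectrum_of_positive {S : H →L[ℂ] H} {c : ℝ}
    (hs : ∀ x y, inner ℂ (S x) y = inner ℂ x (S y)) (h0 : ∀ x, 0 ≤ (inner ℂ (S x) x).re)
    (hc : ‖S‖ ≤ c) {z : ℂ} (hz : z ∈ spectrum ℂ S) : ∃ t : ℝ, z = t ∧ 0 ≤ t ∧ t ≤ c := by
  have hsa : IsSelfAdjoint S := by
    rw [ContinuousLinearMap.isSelfAdjoint_iff_isSymmetric]
    exact hs
  have hp : 0 ≤ S := by
    rw [ContinuousLinearMap.nonneg_iff_isPositive, ContinuousLinearMap.isPositive_def]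
    exact ⟨hs, h0⟩
  have hre := hsa.mem_spectrum_eq_re hz
  have hn : Nontrivial (H →L[ℂ] H) := by
    by_contra h
    rw [not_nontrivial_iff_subsingleton] at h
    rw [spectrum.of_subsingleton] at hz
    exact hz
  have : Nontrivial H := by
    by_contra h
    rw [not_nontrivial_iff_subsingleton] at h
    exact not_subsingleton (H →L[ℂ] H) inferInstance
  refine ⟨z.re, hre, ?_, ?_⟩
  · refine spectrum_nonneg_of_nonneg hp (𝕜 := ℝ) ?_
    rw [hre] at hz
    exact (spectrum.algebraMap_mem_iff ℂ (R := ℝ)).1 hz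
  · exact (Complex.re_le_norm z).trans ((spectrum.norm_le_norm_of_mem hz).trans hc)

/-- Inversion carries the spectrum of `A` into the spectrum of its inverse, which lies in `[0,
ε⁻²]`. -/
theorem exists_real_of_mem_opSpectrum {z : ℂ} (hz : z ∈ opSpectrum A) :
    ∃ t : ℝ, z = t ∧ ε ^ 2 ≤ t := by
  have hB := isResolventOf_zero hA hε hpos
  have hu : ¬ IsUnit (1 - z • opResolvent A 0) := fun h => hz (hB.mem_of_isUnit h)
  have hz0 : z ≠ 0 := by
    rintro rfl
    exact hz (zero_mem_opResolventSet hA hε hpos)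
  have hsp : z⁻¹ ∈ spectrum ℂ (opResolvent A 0) := by
    rw [spectrum.mem_iff]
    intro h
    apply hu
    have h2 : (1 : H →L[ℂ] H) - z • opResolvent A 0 =
        (IsUnit.mk0 z hz0).unit • (algebraMap ℂ (H →L[ℂ] H) z⁻¹ - opResolvent A 0) := by
      rw [Algebra.algebraMap_eq_smul_one, Units.smul_def, IsUnit.unit_spec, smul_sub, smul_smul,
        mul_inv_cancel₀ hz0, one_smul]
    rw [h2]
    exact h.smul _
  obtain ⟨t, ht, h0, h1⟩ := mem_spectrum_of_positive (inner_inv_left hA hε hpos)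
    (re_inner_inv_nonneg hA hε hpos) (norm_inv_le hA hε hpos) hsp
  have ht0 : 0 < t := by
    refine lt_of_le_of_ne h0 fun h => ?_
    rw [← h, Complex.ofReal_zero, inv_eq_zero] at ht
    exact hz0 ht
  refine ⟨t⁻¹, ?_, ?_⟩
  · rw [Complex.ofReal_inv, ← ht, inv_inv]
  · exact (le_inv_comm₀ (by positivity) ht0).2 h1

/-- The inverse is injective; were it onto, the open mapping theorem would bound its inverse, that
is, `A`. -/
theorem not_surjective_inv (hunb : ¬ IsBoundedPMap A) :
    ¬ Function.Surjective (opResolvent A 0) := fun h => by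
  have hB := isResolventOf_zero hA hε hpos
  let e := ContinuousLinearEquiv.ofBijective (opResolvent A 0)
    (LinearMap.ker_eq_bot.2 hB.inv_injective) (LinearMap.range_eq_top.2 h)
  refine hunb ⟨‖(e.symm : H →L[ℂ] H)‖, fun x => ?_⟩
  have hx : A x = e.symm (x : H) := by
    rw [ContinuousLinearEquiv.eq_symm_apply]
    exact hB.inv_map x
  rw [hx]
  exact (e.symm : H →L[ℂ] H).le_opNorm x

/-- If the inverse of `T = 1 - c B` had norm below 1, a Neumann series would make `T (1 - T⁻¹) = T -
1 = -c B` invertible, so `B` would be onto. -/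
theorem one_le_norm_inverse (hunb : ¬ IsBoundedPMap A) {c : ℂ}
    (hu : IsUnit (1 - c • opResolvent A 0)) : 1 ≤ ‖Ring.inverse (1 - c • opResolvent A 0)‖ := by
  by_contra! hlt
  set T : H →L[ℂ] H := 1 - c • opResolvent A 0 with hT
  have h1 : IsUnit (T * (1 - Ring.inverse T)) := hu.mul (isUnit_one_sub_of_norm_lt_one hlt)
  rw [mul_sub, mul_one, Ring.mul_inverse_cancel T hu] at h1
  obtain ⟨u, hu'⟩ := h1
  refine not_surjective_inv hA hε hpos hunb fun x => ⟨-c • (u⁻¹ : (H →L[ℂ] H)ˣ).1 x, ?_⟩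
  have h2 : (u : H →L[ℂ] H) ((u⁻¹ : (H →L[ℂ] H)ˣ).1 x) = x := by
    rw [← mul_apply_eq_comp, Units.mul_inv, one_apply_eq_self]
  rw [hu', hT] at h2
  rw [map_smul]
  simpa using h2

end BoundedBelow

/-! ### The block operator: resolvent, symmetry, spectrum and failure of resolvent growth -/

section Block

variable {H : Type*} [NormedAddCommGroup H] [InnerProductSpace ℂ H]

@[simp] theorem blockJ_fst (f : WithLp 2 (H × H)) : (blockJ H f).fst = Complex.I • f.snd := rfl

@[simp] theorem blockJ_snd (f : WithLp 2 (H × H)) : (blockJ H f).snd = -Complex.I • f.fst := rfl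

theorem blockL_fst (A : H →ₗ.[ℂ] H) (f : (blockL A).domain) :
    (blockL A f).fst = Complex.I • (f : WithLp 2 (H × H)).snd := rfl

theorem blockL_snd (A : H →ₗ.[ℂ] H) (f : (blockL A).domain) :
    (blockL A f).snd = -Complex.I • A ⟨(f : WithLp 2 (H × H)).fst, f.2⟩ := rfl

theorem prod_ext {f g : WithLp 2 (H × H)} (h1 : f.fst = g.fst) (h2 : f.snd = g.snd) : f = g :=
  WithLp.ofLp_injective 2 (Prod.ext h1 h2)

theorem prod_inner (f g : WithLp 2 (H × H)) :
    inner ℂ f g = inner ℂ f.fst g.fst + inner ℂ f.snd g.snd := WithLp.prod_inner_apply f g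

theorem isFundamentalSymmetry_blockJ [CompleteSpace H] : IsFundamentalSymmetry (blockJ H) := by
  constructor
  · rw [ContinuousLinearMap.isSelfAdjoint_iff_isSymmetric]
    intro f g
    change inner ℂ (blockJ H f) g = inner ℂ f (blockJ H g)
    simp only [prod_inner, blockJ_fst, blockJ_snd, inner_smul_left, inner_smul_right]
    simp
    ring
  · intro f
    refine prod_ext ?_ ?_ <;> simp [smul_smul]

theorem norm_snd_le_norm (f : WithLp 2 (H × H)) : ‖f.snd‖ ≤ ‖f‖ := by
  have h := WithLp.prod_norm_sq_eq_of_L2 f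
  exact le_of_sq_le_sq (by nlinarith [sq_nonneg ‖f.fst‖]) (norm_nonneg _)

/-- The operator with matrix entries `a, b, c, d` in `H × H`. -/
def blockOp (a b c d : H →L[ℂ] H) : WithLp 2 (H × H) →L[ℂ] WithLp 2 (H × H) :=
  ((WithLp.prodContinuousLinearEquiv 2 ℂ H H).symm : H × H →L[ℂ] WithLp 2 (H × H)) ∘L
    ((a ∘L ContinuousLinearMap.fst ℂ H H + b ∘L ContinuousLinearMap.snd ℂ H H).prod
      (c ∘L ContinuousLinearMap.fst ℂ H H + d ∘L ContinuousLinearMap.snd ℂ H H)) ∘L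
    ((WithLp.prodContinuousLinearEquiv 2 ℂ H H) : WithLp 2 (H × H) →L[ℂ] H × H)

@[simp] theorem blockOp_fst (a b c d : H →L[ℂ] H) (f : WithLp 2 (H × H)) :
    (blockOp a b c d f).fst = a f.fst + b f.snd := rfl

@[simp] theorem blockOp_snd (a b c d : H →L[ℂ] H) (f : WithLp 2 (H × H)) :
    (blockOp a b c d f).snd = c f.fst + d f.snd := rfl

/-- The resolvent of the block operator in terms of the resolvent of `A`. -/
theorem isResolventOf_blockL {A : H →ₗ.[ℂ] H} {z : ℂ} {R : H →L[ℂ] H}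
    (hR : IsResolventOf A (z ^ 2) R) :
    IsResolventOf (blockL A) z
      (blockOp (z • R) (Complex.I • R) (-Complex.I • (1 + z ^ 2 • R)) (z • R)) := by
  have hI : Complex.I * -Complex.I = 1 := by simp
  have hI' : -Complex.I * Complex.I = 1 := by simp
  set G := blockOp (z • R) (Complex.I • R) (-Complex.I • (1 + z ^ 2 • R)) (z • R)
  have h1 : ∀ g, (G g).fst = R (z • g.fst + Complex.I • g.snd) := fun g => by
    simp [G]
  have h2 : ∀ g, (G g).snd = -Complex.I • (g.fst + z • (G g).fst) := fun g => by
    rw [h1, blockOp_snd]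
    simp only [smul_apply, add_apply, one_apply_eq_self, smul_add, smul_smul, map_add, map_smul]
    rw [show -Complex.I * (z * Complex.I) = z by linear_combination z * hI]
    module
  constructor
  · intro g
    have hA : ∀ v (hv : v ∈ A.domain), v = R (z • g.fst + Complex.I • g.snd) →
        A ⟨v, hv⟩ = z • g.fst + Complex.I • g.snd + z ^ 2 • v := by
      rintro _ _ rfl
      exact hR.apply_apply _ _
    have hx : (G g).fst ∈ A.domain := by rw [h1]; exact hR.mem_domain _
    refine ⟨hx, prod_ext ?_ ?_⟩
    · rw [WithLp.sub_fst, WithLp.smul_fst, blockL_fst]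
      change Complex.I • (G g).snd - z • (G g).fst = g.fst
      rw [h2, smul_smul, hI]
      module
    · rw [WithLp.sub_snd, WithLp.smul_snd, blockL_snd]
      change -Complex.I • A ⟨(G g).fst, hx⟩ - z • (G g).snd = g.snd
      rw [h2, hA _ hx (h1 g)]
      simp only [smul_add, smul_smul]
      rw [hI']
      module
  · intro f
    have h := hR.2 ⟨_, f.2⟩
    have hfst : (G (blockL A f - z • (f : WithLp 2 (H × H)))).fst
        = (f : WithLp 2 (H × H)).fst := by
      rw [h1, WithLp.sub_fst, WithLp.sub_snd, WithLp.smul_fst, WithLp.smul_snd, blockL_fst,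
        blockL_snd]
      refine Eq.trans ?_ h
      congr 1
      simp only [smul_sub, smul_smul]
      rw [hI]
      module
    refine prod_ext hfst ?_
    rw [h2, hfst, WithLp.sub_fst, WithLp.smul_fst, blockL_fst, sub_add_cancel, smul_smul, hI',
      one_smul]

/-- The upper right entry of `(L - z)⁻¹` has to be `i (A - z²)⁻¹`, so the resolvent of `A` is read
off by compressing to that corner and multiplying by `-i`. -/
theorem sq_mem_of_mem_blockL {A : H →ₗ.[ℂ] H} {z : ℂ} (hz : z ∈ opResolventSet (blockL A)) :
    z ^ 2 ∈ opResolventSet A := by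
  obtain ⟨R, hR1, hR2⟩ := hz
  let P : WithLp 2 (H × H) →L[ℂ] H := ContinuousLinearMap.fst ℂ H H ∘L
    ((WithLp.prodContinuousLinearEquiv 2 ℂ H H) : WithLp 2 (H × H) →L[ℂ] H × H)
  let Q : H →L[ℂ] WithLp 2 (H × H) :=
    ((WithLp.prodContinuousLinearEquiv 2 ℂ H H).symm : H × H →L[ℂ] WithLp 2 (H × H)) ∘L
      ContinuousLinearMap.inr ℂ H H
  have hI : -Complex.I * Complex.I = 1 := by simp
  refine ⟨-Complex.I • (P ∘L R ∘L Q), fun x => ?_, fun x => ?_⟩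
  · obtain ⟨hx, hx'⟩ := hR1 (-Complex.I • Q x)
    have h1 := congrArg WithLp.fst hx'
    have h2 := congrArg WithLp.snd hx'
    rw [WithLp.sub_fst, WithLp.smul_fst, blockL_fst, WithLp.smul_fst] at h1
    rw [WithLp.sub_snd, WithLp.smul_snd, blockL_snd, WithLp.smul_snd] at h2
    have hQ1 : (Q x).fst = 0 := rfl
    have hQ2 : (Q x).snd = x := rfl
    have hv : (-Complex.I • (P ∘L R ∘L Q)) x = (R (-Complex.I • Q x)).fst := by
      rw [map_smul]; rfl
    rw [hQ1, smul_zero] at h1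
    rw [hQ2] at h2
    simp only [hv]
    refine ⟨hx, ?_⟩
    simp only at h1 h2
    have h3 : z • (R (-Complex.I • Q x)).snd =
        -Complex.I • z ^ 2 • (R (-Complex.I • Q x)).fst := by
      have : (R (-Complex.I • Q x)).snd = -Complex.I • z • (R (-Complex.I • Q x)).fst := by
        rw [← sub_eq_zero.1 h1, smul_smul, hI, one_smul]
      rw [this, smul_comm z, smul_smul z, sq]
    rw [h3, ← smul_sub] at h2
    exact smul_right_injective _ (neg_ne_zero.2 Complex.I_ne_zero) h2
  · let f : (blockL A).domain := ⟨WithLp.toLp 2 ((x : H), -Complex.I • z • (x : H)), x.2⟩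
    have h := congrArg WithLp.fst (hR2 f)
    have h2 : blockL A f - z • (f : WithLp 2 (H × H)) =
        -Complex.I • Q (A x - z ^ 2 • (x : H)) := by
      refine prod_ext ?_ ?_
      · rw [WithLp.sub_fst, WithLp.smul_fst, blockL_fst, WithLp.smul_fst]
        change Complex.I • -Complex.I • z • (x : H) - z • (x : H) = -Complex.I • (0 : H)
        rw [smul_smul, mul_comm, hI, one_smul, sub_self, smul_zero]
      · rw [WithLp.sub_snd, WithLp.smul_snd, blockL_snd, WithLp.smul_snd]
        change -Complex.I • A x - z • -Complex.I • z • (x : H) =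
          -Complex.I • (A x - z ^ 2 • (x : H))
        rw [smul_comm z, smul_smul z, ← sq, smul_sub]
    rw [h2, map_smul] at h
    exact h

theorem mem_opResolventSet_blockL_iff {A : H →ₗ.[ℂ] H} {z : ℂ} :
    z ∈ opResolventSet (blockL A) ↔ z ^ 2 ∈ opResolventSet A :=
  ⟨sq_mem_of_mem_blockL, fun ⟨_, hR⟩ => (isResolventOf_blockL hR).mem_opResolventSet⟩

variable [CompleteSpace H] {A : H →ₗ.[ℂ] H} (hA : IsSelfAdjoint A) {ε : ℝ} (hε : 0 < ε)
  (hpos : ∀ x : A.domain, ε ^ 2 * ‖(x : H)‖ ^ 2 ≤ (inner ℂ (A x) (x : H)).re)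

theorem blockJ_blockL_fst (f : (blockL A).domain) :
    (blockJ H (blockL A f)).fst = A ⟨(f : WithLp 2 (H × H)).fst, f.2⟩ := by
  rw [blockJ_fst, blockL_snd, smul_smul]
  simp

theorem blockJ_blockL_snd (f : (blockL A).domain) :
    (blockJ H (blockL A f)).snd = (f : WithLp 2 (H × H)).snd := by
  rw [blockJ_snd, blockL_fst, smul_smul]
  simp

include hA hε hpos

/-- The product `J L` is the diagonal operator `A ⊕ I`, symmetric and onto. -/
theorem isJSelfAdjoint_blockL : IsJSelfAdjoint (blockJ H) (blockL A) := by
  refine isSelfAdjoint_of_surjective ?_ ?_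
  · intro x y
    change inner ℂ (blockJ H (blockL A x)) (y : WithLp 2 (H × H)) =
      inner ℂ (x : WithLp 2 (H × H)) (blockJ H (blockL A y))
    rw [prod_inner, prod_inner, blockJ_blockL_fst (A := A) x, blockJ_blockL_snd (A := A) x,
      blockJ_blockL_fst (A := A) y, blockJ_blockL_snd (A := A) y]
    exact congrArg (· + _) (inner_map_of_isSelfAdjoint hA ⟨_, x.2⟩ ⟨_, y.2⟩)
  · intro y
    obtain ⟨x, hx⟩ := surjective_of_boundedBelow hA hε hpos y.fst
    let f : (blockL A).domain := ⟨WithLp.toLp 2 ((x : H), y.snd), x.2⟩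
    refine ⟨f, ?_⟩
    change blockJ H (blockL A f) = y
    refine prod_ext ?_ ?_
    · rw [blockJ_blockL_fst]
      exact hx
    · exact blockJ_blockL_snd (A := A) f

omit hA in
theorem isJPositive_blockL : IsJPositive (blockJ H) (blockL A) := by
  intro x hx
  rw [kreinInner, prod_inner, blockJ_blockL_fst, blockJ_blockL_snd, Complex.add_re]
  have h1 := hpos ⟨_, x.2⟩
  have h2 : (inner ℂ (x : WithLp 2 (H × H)).snd (x : WithLp 2 (H × H)).snd).re =
      ‖(x : WithLp 2 (H × H)).snd‖ ^ 2 := inner_self_eq_norm_sq (𝕜 := ℂ) _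
  rw [h2]
  simp only at h1
  by_cases h : (x : WithLp 2 (H × H)).fst = 0
  · have h3 : (x : WithLp 2 (H × H)).snd ≠ 0 := fun h' => hx (prod_ext h h')
    have : 0 < ‖(x : WithLp 2 (H × H)).snd‖ ^ 2 := by positivity
    have : 0 ≤ ε ^ 2 * ‖(x : WithLp 2 (H × H)).fst‖ ^ 2 := by positivity
    linarith
  · have : 0 ≤ ‖(x : WithLp 2 (H × H)).snd‖ ^ 2 := by positivity
    have : 0 < ε ^ 2 * ‖(x : WithLp 2 (H × H)).fst‖ ^ 2 := by positivity
    linarith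

omit hA in
theorem isJNonneg_blockL : IsJNonneg (blockJ H) (blockL A) := by
  intro x
  by_cases hx : (x : WithLp 2 (H × H)) = 0
  · rw [kreinInner, hx, inner_zero_right, Complex.zero_re]
  · exact (isJPositive_blockL hε hpos x hx).le

theorem exists_real_of_mem_opSpectrum_blockL {z : ℂ} (hz : z ∈ opSpectrum (blockL A)) :
    ∃ t : ℝ, z = t ∧ (t : ℂ) ^ 2 ∈ opSpectrum A ∧ t ∉ Set.Ioo (-ε) ε := by
  have h1 : z ^ 2 ∈ opSpectrum A := fun h => hz (mem_opResolventSet_blockL_iff.2 h)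
  obtain ⟨s, hs, hs'⟩ := exists_real_of_mem_opSpectrum hA hε hpos h1
  have h2 : z = (√s : ℝ) ∨ z = -(√s : ℝ) := by
    rw [← sq_eq_sq_iff_eq_or_eq_neg, hs, ← Complex.ofReal_pow, Real.sq_sqrt]
    exact le_trans (by positivity) hs'
  have h3 : ε ≤ √s := Real.le_sqrt_of_sq_le hs'
  rcases h2 with h | h
  · exact ⟨√s, h, h ▸ h1, fun h' => absurd h'.2 (not_lt.2 h3)⟩
  · refine ⟨-√s, by rw [h]; simp, ?_, fun h' => ?_⟩
    · rw [Complex.ofReal_neg, ← h]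
      exact h1
    · have := h'.1
      linarith

theorem opSpectrum_blockL : opSpectrum (blockL A) =
    {z : ℂ | ∃ t : ℝ, z = (t : ℂ) ∧ ((t : ℂ)) ^ 2 ∈ opSpectrum A} := by
  ext z
  constructor
  · intro hz
    obtain ⟨t, h1, h2, -⟩ := exists_real_of_mem_opSpectrum_blockL hA hε hpos hz
    exact ⟨t, h1, h2⟩
  · rintro ⟨t, rfl, ht⟩ h
    exact ht (mem_opResolventSet_blockL_iff.1 h)

theorem mem_opResolventSet_blockL_of_im_ne {z : ℂ} (hz : z.im ≠ 0) :
    z ∈ opResolventSet (blockL A) := by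
  by_contra h
  obtain ⟨t, rfl, -⟩ := exists_real_of_mem_opSpectrum_blockL hA hε hpos h
  simp at hz

theorem schurT_apply (z : ℂ) (x : H) : ∃ h : opResolvent A 0 x ∈ A.domain,
    schurT A z x = A ⟨opResolvent A 0 x, h⟩ - z ^ 2 • opResolvent A 0 x := by
  have hB := isResolventOf_zero hA hε hpos
  refine ⟨hB.mem_domain x, ?_⟩
  rw [hB.map_map_inv]
  rfl

theorem isUnit_schurT {z : ℂ} (hz : z ∈ opResolventSet (blockL A)) : IsUnit (schurT A z) :=
  (isResolventOf_zero hA hε hpos).isUnit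
    (isResolventOf_opResolvent _ _ (sq_mem_of_mem_blockL hz))

theorem inverse_schurT {z : ℂ} (hz : z ∈ opResolventSet (blockL A)) :
    Ring.inverse (schurT A z) = 1 + z ^ 2 • opResolvent A (z ^ 2) :=
  (isResolventOf_zero hA hε hpos).inverse_eq
    (isResolventOf_opResolvent _ _ (sq_mem_of_mem_blockL hz))

/-- Applied to `(x, 0)`, the resolvent has second component `-i T(z)⁻¹ x`, so its norm dominates
that of `T(z)⁻¹`. -/
theorem one_le_norm_resolvent_blockL (hunb : ¬ IsBoundedPMap A) {z : ℂ}
    (hz : z ∈ opResolventSet (blockL A)) : 1 ≤ ‖opResolvent (blockL A) z‖ := by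
  have hR := isResolventOf_opResolvent A _ (sq_mem_of_mem_blockL hz)
  refine (one_le_norm_inverse hA hε hpos hunb (isUnit_schurT hA hε hpos hz)).trans ?_
  rw [show (1 : H →L[ℂ] H) - z ^ 2 • opResolvent A 0 = schurT A z from rfl,
    inverse_schurT hA hε hpos hz, (isResolventOf_blockL hR).eq_opResolvent]
  refine ContinuousLinearMap.opNorm_le_bound _ (norm_nonneg _) fun x => ?_
  have h1 := ContinuousLinearMap.le_opNorm (blockOp (z • opResolvent A (z ^ 2))
    (Complex.I • opResolvent A (z ^ 2)) (-Complex.I • (1 + z ^ 2 • opResolvent A (z ^ 2)))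
    (z • opResolvent A (z ^ 2))) (WithLp.toLp 2 (x, (0 : H)))
  have h2 : ‖(WithLp.toLp 2 (x, (0 : H)) : WithLp 2 (H × H))‖ = ‖x‖ := by simp
  rw [h2] at h1
  refine le_trans (le_trans (le_of_eq ?_) (norm_snd_le_norm _)) h1
  rw [blockOp_snd]
  have h3 : (-Complex.I • (1 + z ^ 2 • opResolvent A (z ^ 2))) x +
      (z • opResolvent A (z ^ 2)) (0 : H) = -Complex.I • (1 + z ^ 2 • opResolvent A (z ^ 2)) x := by
    rw [map_zero, add_zero, smul_apply]
  refine Eq.trans ?_ (congrArg norm h3.symm)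
  rw [norm_smul]
  simp

theorem not_linearResolventGrowth_blockL (hunb : ¬ IsBoundedPMap A) :
    ¬ LinearResolventGrowth (blockL A) := by
  rintro ⟨c, hc, h⟩
  -- At `z = 2 c i` the growth bound is `c / (2 c) = 1/2`, below the lower bound 1.
  obtain ⟨h1, h2⟩ := h ((2 * c : ℝ) * Complex.I) (by simp [hc.ne'])
  have h3 := (one_le_norm_resolvent_blockL hA hε hpos hunb h1).trans h2
  have h4 : |((2 * c : ℝ) * Complex.I).im| = 2 * c := by
    simp [abs_of_pos hc]
  rw [h4, le_div_iff₀ (by positivity)] at h3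
  linarith

end Block

/-! ### Similarity to a self-adjoint operator implies linear resolvent growth -/

section Similarity

variable {K : Type*} [NormedAddCommGroup K] [InnerProductSpace ℂ K] [CompleteSpace K]

theorem norm_im_mul_le {S : K →ₗ.[ℂ] K} (hS : IsSelfAdjoint S) (z : ℂ) (y : S.domain) :
    |z.im| * ‖(y : K)‖ ≤ ‖S y - z • (y : K)‖ := by
  rcases eq_or_ne (y : K) 0 with h | h
  · rw [h]; simp
  · have h1 : (inner ℂ (y : K) (S y - z • (y : K))).im = - (z.im * ‖(y : K)‖ ^ 2) := by
      rw [inner_sub_right, inner_smul_right, Complex.sub_im]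
      have h2 : (inner ℂ (y : K) (S y)).im = 0 := by
        rw [← Complex.conj_eq_iff_im, inner_conj_symm]
        exact inner_map_of_isSelfAdjoint hS y y
      have h3 : inner ℂ (y : K) (y : K) = ((‖(y : K)‖ ^ 2 : ℝ) : ℂ) := by
        rw [inner_self_eq_norm_sq_to_K]; simp
      rw [h2, h3, Complex.im_mul_ofReal, zero_sub]
    have h4 := (Complex.abs_im_le_norm _).trans
      (norm_inner_le_norm (𝕜 := ℂ) (y : K) (S y - z • (y : K)))
    rw [h1, abs_neg, abs_mul, abs_of_nonneg (sq_nonneg ‖(y : K)‖)] at h4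
    have h5 : 0 < ‖(y : K)‖ := norm_pos_iff.2 h
    refine le_of_mul_le_mul_left ?_ h5
    linarith

/-- An operator similar to a self-adjoint one has linear resolvent growth. -/
theorem linearResolventGrowth_of_isSimilar {T : K →ₗ.[ℂ] K} (h : IsSimilarToSelfAdjoint T)
    (hz : ∀ z : ℂ, z.im ≠ 0 → z ∈ opResolventSet T) : LinearResolventGrowth T := by
  obtain ⟨V, S, hS, hdom, hV⟩ := h
  -- The condition number of `V` is the natural constant; the added 1 keeps it positive even on the
  -- zero space.
  refine ⟨‖(V.symm : K →L[ℂ] K)‖ * ‖(V : K →L[ℂ] K)‖ + 1, by positivity, fun z hzi =>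
    ⟨hz z hzi, ?_⟩⟩
  have hp : 0 < |z.im| := abs_pos.2 hzi
  have hR := isResolventOf_opResolvent T z (hz z hzi)
  refine ContinuousLinearMap.opNorm_le_bound _ (by positivity) fun x => ?_
  obtain ⟨hx, hx'⟩ := hR.1 x
  set u := opResolvent T z x
  have h1 := norm_im_mul_le hS z ⟨V u, (hdom u).1 hx⟩
  rw [← hV ⟨u, hx⟩ ⟨V u, (hdom u).1 hx⟩ rfl] at h1
  simp only at h1
  rw [← map_smul, ← map_sub, hx'] at h1
  have h2 : ‖u‖ ≤ ‖(V.symm : K →L[ℂ] K)‖ * ‖V u‖ := by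
    simpa using (V.symm : K →L[ℂ] K).le_opNorm (V u)
  have h3 : ‖V x‖ ≤ ‖(V : K →L[ℂ] K)‖ * ‖x‖ := (V : K →L[ℂ] K).le_opNorm x
  rw [div_mul_eq_mul_div, le_div_iff₀ hp]
  calc ‖u‖ * |z.im| ≤ ‖(V.symm : K →L[ℂ] K)‖ * ‖V u‖ * |z.im| := by gcongr
    _ = ‖(V.symm : K →L[ℂ] K)‖ * (|z.im| * ‖V u‖) := by ring
    _ ≤ ‖(V.symm : K →L[ℂ] K)‖ * (‖(V : K →L[ℂ] K)‖ * ‖x‖) := by exact mul_le_mul_of_nonneg_left (h1.trans h3) (norm_nonneg _)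
    _ ≤ (‖(V.symm : K →L[ℂ] K)‖ * ‖(V : K →L[ℂ] K)‖ + 1) * ‖x‖ := by
      nlinarith [norm_nonneg x]

end Similarity

/-! ### Functional calculus for a square root `G` of `S`, by even and odd parts -/

section GapCalculus

variable {K : Type*} [NormedAddCommGroup K] [InnerProductSpace ℂ K] [CompleteSpace K]

/-- `S` is an injective positive operator with `‖S‖ ≤ ε⁻²`. -/
structure IsInverseSquare (S : K →L[ℂ] K) (ε : ℝ) : Prop where
  pos : 0 < ε
  symm : ∀ x y, inner ℂ (S x) y = inner ℂ x (S y)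
  nonneg : ∀ x, 0 ≤ (inner ℂ (S x) x).re
  norm_le : ‖S‖ ≤ (ε ^ 2)⁻¹
  inj : Function.Injective S

/-- Measurable functions on the line that are bounded on `[ε, ∞)`. -/
def BddOnRay (ε : ℝ) (k : ℝ → ℂ) : Prop := Measurable k ∧ ∃ M : ℝ, ∀ s, ε ≤ s → ‖k s‖ ≤ M

namespace BddOnRay

variable {ε : ℝ} {k l : ℝ → ℂ}

theorem add (hk : BddOnRay ε k) (hl : BddOnRay ε l) : BddOnRay ε (k + l) := by
  obtain ⟨hk, M, hM⟩ := hk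
  obtain ⟨hl, N, hN⟩ := hl
  exact ⟨hk.add hl, M + N, fun t ht =>
    (norm_add_le _ _).trans (add_le_add (hM t ht) (hN t ht))⟩

theorem mul (hk : BddOnRay ε k) (hl : BddOnRay ε l) : BddOnRay ε (k * l) := by
  obtain ⟨hk, M, hM⟩ := hk
  obtain ⟨hl, N, hN⟩ := hl
  refine ⟨hk.mul hl, M * N, fun t ht => ?_⟩
  simp only [Pi.mul_apply, norm_mul]
  exact mul_le_mul (hM t ht) (hN t ht) (norm_nonneg _) ((norm_nonneg _).trans (hM t ht))

theorem const (c : ℂ) : BddOnRay ε (fun _ => c) := ⟨measurable_const, ‖c‖, fun _ _ => le_rfl⟩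

theorem inv_sq (hε : 0 < ε) : BddOnRay ε (fun s => ((s : ℂ) ^ 2)⁻¹) := by
  refine ⟨(Complex.measurable_ofReal.pow_const 2).inv, (ε ^ 2)⁻¹, fun s hs => ?_⟩
  have h0 : 0 < s := hε.trans_le hs
  rw [norm_inv, norm_pow, Complex.norm_real, Real.norm_of_nonneg h0.le]
  gcongr

end BddOnRay

variable {S : K →L[ℂ] K} {ε : ℝ}

/-- The function of `S` with the value `k s` at the spectral point `s⁻²`. -/
def rayCalc (S : K →L[ℂ] K) (hS : IsStarNormal S) (k : ℝ → ℂ) : K →L[ℂ] K :=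
  borelCalc (cfcHom (R := ℂ) hS) (fun w : spectrum ℂ S => k ((√ w.1.re)⁻¹))

namespace IsInverseSquare

theorem isSelfAdjoint (hS : IsInverseSquare S ε) : IsSelfAdjoint S := by
  rw [ContinuousLinearMap.isSelfAdjoint_iff_isSymmetric]
  exact hS.symm

theorem isStarNormal (hS : IsInverseSquare S ε) : IsStarNormal S := hS.isSelfAdjoint.isStarNormal

/-- The function of `S` with the value `k s` at the spectral point `s⁻²`. -/
abbrev fn (hS : IsInverseSquare S ε) (k : ℝ → ℂ) : K →L[ℂ] K := rayCalc S hS.isStarNormal k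

variable (hS : IsInverseSquare S ε) {k l : ℝ → ℂ}

include hS

/-- The substitution `w = s⁻²` maps the spectrum into `[ε, ∞)`, apart from `w = 0`, which stands for
infinity. -/
theorem spectrum_cases (w : spectrum ℂ S) :
    (w.1 : ℂ) = 0 ∨ ∃ s : ℝ, ε ≤ s ∧ (√ w.1.re)⁻¹ = s := by
  obtain ⟨t, ht, h0, h1⟩ := mem_spectrum_of_positive hS.symm hS.nonneg hS.norm_le w.2
  rcases h0.eq_or_lt with h | h
  · left; rw [ht, ← h, Complex.ofReal_zero]
  · right
    refine ⟨_, ?_, rfl⟩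
    rw [ht, Complex.ofReal_re, le_inv_comm₀ hS.pos (Real.sqrt_pos.2 h)]
    refine Real.sqrt_le_iff.2 ⟨inv_nonneg.2 hS.pos.le, ?_⟩
    rwa [inv_pow]

theorem bddMeas (hk : BddOnRay ε k) :
    BddMeas (fun w : spectrum ℂ S => k ((√ w.1.re)⁻¹)) := by
  obtain ⟨hk, M, hM⟩ := hk
  -- At `w = 0` the convention `0⁻¹ = 0` evaluates `k` at 0, a point outside the ray, so its value
  -- enters the bound separately.
  refine ⟨hk.comp (Measurable.inv ?_), max M ‖k 0‖, fun w => ?_⟩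
  · exact (Real.continuous_sqrt.comp (Complex.continuous_re.comp continuous_subtype_val)).measurable
  · rcases hS.spectrum_cases w with h | ⟨s, hs, h⟩
    · simp [h]
    · simp only [h]
      exact (hM s hs).trans (le_max_left _ _)

theorem fn_add (hk : BddOnRay ε k) (hl : BddOnRay ε l) :
    hS.fn (k + l) = hS.fn k + hS.fn l :=
  borelCalc_add (hS.bddMeas hk) (hS.bddMeas hl)

theorem fn_mul (hk : BddOnRay ε k) (hl : BddOnRay ε l) :
    hS.fn (k * l) = hS.fn k * hS.fn l :=
  borelCalc_mul (hS.bddMeas hk) (hS.bddMeas hl)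

theorem fn_const (c : ℂ) : hS.fn (fun _ => c) = c • 1 := by
  have h := borelCalc_continuousMap (cfcHom (R := ℂ) hS.isStarNormal)
    (algebraMap ℂ C(spectrum ℂ S, ℂ) c)
  rw [AlgHomClass.commutes] at h
  rw [← Algebra.algebraMap_eq_smul_one]
  exact h

theorem fn_smul (c : ℂ) (hk : BddOnRay ε k) : hS.fn (fun s => c * k s) = c • hS.fn k := by
  have h := hS.fn_mul (BddOnRay.const c) hk
  rw [hS.fn_const, smul_mul_assoc, one_mul] at h
  exact h

theorem fn_inv_sq : hS.fn (fun s => ((s : ℂ) ^ 2)⁻¹) = S := by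
  have h := borelCalc_continuousMap (cfcHom (R := ℂ) hS.isStarNormal)
    ((ContinuousMap.id ℂ).restrict (spectrum ℂ S))
  rw [cfcHom_id] at h
  refine Eq.trans ?_ h
  unfold fn rayCalc
  congr 1
  ext w
  obtain ⟨t, ht, h0, -⟩ := mem_spectrum_of_positive hS.symm hS.nonneg hS.norm_le w.2
  simp only [ContinuousMap.restrict_apply, ContinuousMap.id_apply, ht, Complex.ofReal_re]
  rw [← Complex.ofReal_pow, inv_pow, Real.sq_sqrt h0, Complex.ofReal_inv, inv_inv]

/-- The spurious value at `w = 0` is harmless: multiplying the difference by `S` kills it there, and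
`S` is injective. -/
theorem fn_congr (hk : BddOnRay ε k) (hl : BddOnRay ε l) (h : ∀ s, ε ≤ s → k s = l s) :
    hS.fn k = hS.fn l := by
  have h1 := hS.bddMeas hk
  have h2 := hS.bddMeas hl
  have h3 := borelCalc_continuousMap_mul (φ := cfcHom (R := ℂ) hS.isStarNormal)
    ((ContinuousMap.id ℂ).restrict (spectrum ℂ S)) (h1.sub h2)
  have h4 : (⇑((ContinuousMap.id ℂ).restrict (spectrum ℂ S)) *
      ((fun w : spectrum ℂ S => k ((√ w.1.re)⁻¹)) - fun w => l ((√ w.1.re)⁻¹))) =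
      fun _ => 0 := by
    ext w
    simp only [Pi.mul_apply, Pi.sub_apply, ContinuousMap.restrict_apply, ContinuousMap.id_apply]
    rcases hS.spectrum_cases w with h' | ⟨s, hs, h'⟩
    · rw [h', zero_mul]
    · rw [h', h s hs, sub_self, mul_zero]
  have h5 : hS.fn (fun _ => 0) = 0 := by rw [fn_const, zero_smul]
  rw [h4, cfcHom_id, borelCalc_sub h1 h2] at h3
  have h6 : S * (hS.fn k - hS.fn l) = 0 := h3.symm.trans h5
  ext x
  have h7 := congrArg (fun T : K →L[ℂ] K => T x) h6
  simp only [mul_apply_eq_comp, sub_apply, zero_apply] at h7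
  exact sub_eq_zero.1 (hS.inj (h7.trans (map_zero S).symm))

theorem inner_fn_left (hk : BddOnRay ε k) (x y : K) :
    inner ℂ (hS.fn k x) y = inner ℂ x (hS.fn (star k) y) :=
  inner_borelCalc_left (hS.bddMeas hk) x y

theorem commute_fn {T : K →L[ℂ] K} (hT : Commute T S) (k : ℝ → ℂ) : Commute T (hS.fn k) :=
  commute_borelCalc T fun g =>
    (IsSelfAdjoint.commute_cfcHom hS.isStarNormal hS.isSelfAdjoint hT.symm g).symm

theorem tendsto_fn {k : ℝ → ℂ} {l : ℕ → ℝ → ℂ} (hk : Measurable k) (hl : ∀ n, Measurable (l n))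
    {M : ℝ} (hM : ∀ n s, ε ≤ s → ‖l n s‖ ≤ M)
    (h : ∀ s, ε ≤ s → Tendsto (fun n => l n s) atTop (𝓝 (k s))) (x : K) :
    Tendsto (fun n => hS.fn (l n) x) atTop (𝓝 (hS.fn k x)) := by
  have hkM : ∀ s, ε ≤ s → ‖k s‖ ≤ M := fun s hs =>
    le_of_tendsto (h s hs).norm (Eventually.of_forall fun n => hM n s hs)
  -- Cutting off to `[ε, ∞)` does not change the operators, but gives a uniform bound and
  -- convergence at the spurious value 0 as well.
  have hind : ∀ {u : ℝ → ℂ}, Measurable u → (∀ s, ε ≤ s → ‖u s‖ ≤ M) →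
      Measurable ((Set.Ici ε).indicator u) ∧ (∀ s, ‖(Set.Ici ε).indicator u s‖ ≤ |M|) ∧
      hS.fn u = hS.fn ((Set.Ici ε).indicator u) := fun {u} hu hM => by
    have h1 : ∀ s, ‖(Set.Ici ε).indicator u s‖ ≤ |M| := fun s => by
      by_cases hs : s ∈ Set.Ici ε
      · rw [Set.indicator_of_mem hs]
        exact (hM s hs).trans (le_abs_self M)
      · rw [Set.indicator_of_notMem hs, norm_zero]
        exact abs_nonneg M
    have h2 := hu.indicator (measurableSet_Ici (a := ε))
    refine ⟨h2, h1, hS.fn_congr ⟨hu, M, hM⟩ ⟨h2, _, fun s _ => h1 s⟩ fun s hs => ?_⟩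
    rw [Set.indicator_of_mem (show s ∈ Set.Ici ε from hs)]
  obtain ⟨hk1, hk2, hk3⟩ := hind hk hkM
  rw [hk3]
  simp only [fun n => (hind (hl n) (hM n)).2.2]
  refine tendsto_borelCalc (hS.bddMeas ⟨hk1, _, fun s _ => hk2 s⟩)
    (fun n => (hS.bddMeas ⟨(hind (hl n) (hM n)).1, _, fun s _ => (hind (hl n) (hM n)).2.1 s⟩).1)
    (M := |M|) (fun n t => (hind (hl n) (hM n)).2.1 _) (fun t => ?_) x
  by_cases hs : (√ t.1.re)⁻¹ ∈ Set.Ici ε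
  · simp only [Set.indicator_of_mem hs]
    exact h _ hs
  · simp only [Set.indicator_of_notMem hs]
    exact tendsto_const_nhds

end IsInverseSquare

/-- The even part of a function on the line. -/
def evenPart (h : ℝ → ℂ) (s : ℝ) : ℂ := (h s + h (-s)) / 2

/-- The even function `k` for which `k s / s` is the odd part of `h`. -/
def oddPart (h : ℝ → ℂ) (s : ℝ) : ℂ := s * (h s - h (-s)) / 2

/-- The functions to which the functional calculus of a `J`-positive operator with the spectral
gap `(-ε, ε)` applies. -/
def GapAdmissible (ε : ℝ) (h : ℝ → ℂ) : Prop :=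
  BddOnRay ε (evenPart h) ∧ BddOnRay ε (oddPart h)

/-- Multiplication of `e + s⁻¹ o` by `e' + s⁻¹ o'`: the product of the two odd terms is even and
carries the factor `s⁻²`, which becomes `S = G²` in the calculus. -/
theorem evenPart_mul (h k : ℝ → ℂ) : evenPart (h * k) =
    evenPart h * evenPart k + (fun s : ℝ => ((s : ℂ) ^ 2)⁻¹) * (oddPart h * oddPart k) := by
  ext s
  rcases eq_or_ne s 0 with rfl | hs
  · simp [evenPart, oddPart]
  · have : (s : ℂ) ≠ 0 := Complex.ofReal_ne_zero.2 hs
    simp only [evenPart, oddPart, Pi.mul_apply, Pi.add_apply]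
    field_simp
    ring

theorem oddPart_mul (h k : ℝ → ℂ) : oddPart (h * k) =
    evenPart h * oddPart k + oddPart h * evenPart k := by
  ext s
  simp only [evenPart, oddPart, Pi.mul_apply, Pi.add_apply]
  ring

theorem evenPart_add (h k : ℝ → ℂ) : evenPart (h + k) = evenPart h + evenPart k := by
  ext s
  simp only [evenPart, Pi.add_apply]
  ring

theorem oddPart_add (h k : ℝ → ℂ) : oddPart (h + k) = oddPart h + oddPart k := by
  ext s
  simp only [oddPart, Pi.add_apply]
  ring

theorem evenPart_const (c : ℂ) : evenPart (fun _ => c) = fun _ => c := by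
  ext s
  simp only [evenPart]
  ring

theorem oddPart_const (c : ℂ) : oddPart (fun _ => c) = fun _ => 0 := by
  ext s
  simp [oddPart]

theorem measurable_evenPart {h : ℝ → ℂ} (hh : Measurable h) : Measurable (evenPart h) :=
  (hh.add (hh.comp measurable_neg)).div_const 2

theorem measurable_oddPart {h : ℝ → ℂ} (hh : Measurable h) : Measurable (oddPart h) :=
  (Complex.measurable_ofReal.mul (hh.sub (hh.comp measurable_neg))).div_const 2

theorem norm_evenPart_le {h : ℝ → ℂ} {M : ℝ} (hM : ∀ s : ℝ, ε ≤ |s| → ‖h s‖ ≤ M) {s : ℝ}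
    (hs : ε ≤ s) : ‖evenPart h s‖ ≤ M := by
  have h1 := hM s (hs.trans (le_abs_self s))
  have h2 := hM (-s) (by rw [abs_neg]; exact hs.trans (le_abs_self s))
  have h3 := norm_add_le (h s) (h (-s))
  rw [evenPart, norm_div, Complex.norm_ofNat]
  linarith

theorem norm_oddPart_le {h : ℝ → ℂ} {M : ℝ} (hM : ∀ s : ℝ, ε ≤ |s| → ‖s * h s‖ ≤ M) {s : ℝ}
    (hs : ε ≤ s) : ‖oddPart h s‖ ≤ M := by
  have h1 := norm_evenPart_le (h := fun s => s * h s) hM hs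
  have h2 : oddPart h s = evenPart (fun s => s * h s) s := by
    simp only [oddPart, evenPart, Complex.ofReal_neg]
    ring
  rwa [h2]

namespace GapAdmissible

variable {h k : ℝ → ℂ}

theorem of_bounded (hh : Measurable h) {M N : ℝ} (hM : ∀ s : ℝ, ε ≤ |s| → ‖h s‖ ≤ M)
    (hN : ∀ s : ℝ, ε ≤ |s| → ‖s * h s‖ ≤ N) : GapAdmissible ε h :=
  ⟨⟨measurable_evenPart hh, M, fun _ hs => norm_evenPart_le hM hs⟩,
    ⟨measurable_oddPart hh, N, fun _ hs => norm_oddPart_le hN hs⟩⟩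

theorem add (hh : GapAdmissible ε h) (hk : GapAdmissible ε k) : GapAdmissible ε (h + k) := by
  rw [GapAdmissible, evenPart_add, oddPart_add]
  exact ⟨hh.1.add hk.1, hh.2.add hk.2⟩

theorem mul (hε : 0 < ε) (hh : GapAdmissible ε h) (hk : GapAdmissible ε k) :
    GapAdmissible ε (h * k) := by
  rw [GapAdmissible, evenPart_mul, oddPart_mul]
  exact ⟨(hh.1.mul hk.1).add ((BddOnRay.inv_sq hε).mul (hh.2.mul hk.2)),
    (hh.1.mul hk.2).add (hh.2.mul hk.1)⟩

theorem const (c : ℂ) : GapAdmissible ε (fun _ => c) := by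
  rw [GapAdmissible, evenPart_const, oddPart_const]
  exact ⟨.const c, .const 0⟩

theorem inv (hε : 0 < ε) : GapAdmissible ε (fun s => (s : ℂ)⁻¹) := by
  refine of_bounded Complex.measurable_ofReal.inv (M := ε⁻¹) (N := 1) (fun s hs => ?_)
    fun s hs => ?_
  · rw [norm_inv, Complex.norm_real, Real.norm_eq_abs]
    gcongr
  · have : (s : ℂ) ≠ 0 := Complex.ofReal_ne_zero.2 (abs_pos.1 (hε.trans_le hs))
    rw [mul_inv_cancel₀ this, norm_one]

end GapAdmissible

/-- The functional calculus of the operator `G⁻¹`, where `G ^ 2 = S`. -/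
def IsInverseSquare.lineCalc (hS : IsInverseSquare S ε) (G : K →L[ℂ] K) (h : ℝ → ℂ) :
    K →L[ℂ] K :=
  hS.fn (evenPart h) + G * hS.fn (oddPart h)

namespace IsInverseSquare

variable (hS : IsInverseSquare S ε) {G : K →L[ℂ] K} {h k : ℝ → ℂ}

theorem lineCalc_congr (hh : GapAdmissible ε h) (hk : GapAdmissible ε k)
    (hhk : ∀ s : ℝ, ε ≤ |s| → h s = k s) : hS.lineCalc G h = hS.lineCalc G k := by
  have h1 : ∀ s, ε ≤ s → h s = k s ∧ h (-s) = k (-s) := fun s hs =>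
    ⟨hhk _ (hs.trans (le_abs_self s)), hhk _ (by rw [abs_neg]; exact hs.trans (le_abs_self s))⟩
  rw [lineCalc, lineCalc, hS.fn_congr hh.1 hk.1 fun s hs => by
    rw [evenPart, evenPart, (h1 s hs).1, (h1 s hs).2],
    hS.fn_congr hh.2 hk.2 fun s hs => by rw [oddPart, oddPart, (h1 s hs).1, (h1 s hs).2]]

theorem lineCalc_add (hh : GapAdmissible ε h) (hk : GapAdmissible ε k) :
    hS.lineCalc G (h + k) = hS.lineCalc G h + hS.lineCalc G k := by
  rw [lineCalc, evenPart_add, oddPart_add, hS.fn_add hh.1 hk.1, hS.fn_add hh.2 hk.2, mul_add,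
    lineCalc, lineCalc]
  abel

theorem lineCalc_const (c : ℂ) : hS.lineCalc G (fun _ => c) = c • 1 := by
  rw [lineCalc, evenPart_const, oddPart_const, fn_const, fn_const, zero_smul, mul_zero,
    add_zero]

theorem lineCalc_inv : hS.lineCalc G (fun s => (s : ℂ)⁻¹) = G := by
  have h1 : evenPart (fun s => (s : ℂ)⁻¹) = fun _ => 0 := by
    ext s
    simp [evenPart, inv_neg]
  have h2 : hS.fn (oddPart fun s => (s : ℂ)⁻¹) = 1 := by
    rw [← one_smul ℂ (1 : K →L[ℂ] K), ← hS.fn_const 1]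
    refine hS.fn_congr (GapAdmissible.inv hS.pos).2 (.const 1) fun s hs => ?_
    have : (s : ℂ) ≠ 0 := Complex.ofReal_ne_zero.2 (hS.pos.trans_le hs).ne'
    simp only [oddPart, Complex.ofReal_neg, inv_neg]
    field_simp
    norm_num
  rw [lineCalc, h1, h2, fn_const, zero_smul, zero_add, mul_one]

theorem commute_lineCalc {T : K →L[ℂ] K} (hTS : Commute T S) (hTG : Commute T G) (h : ℝ → ℂ) :
    Commute T (hS.lineCalc G h) :=
  (hS.commute_fn hTS _).add_right (hTG.mul_right (hS.commute_fn hTS _))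

section Square

variable (hG : G * G = S)

include hG

theorem commute_square : Commute G S := by
  rw [← hG]
  exact (Commute.refl G).mul_right (Commute.refl G)

/-- The parity product rules match the expansion of `(e + G o) (e' + G o')`, because `G` commutes
with functions of `S` and `G²` is `S`. -/
theorem lineCalc_mul (hh : GapAdmissible ε h) (hk : GapAdmissible ε k) :
    hS.lineCalc G (h * k) = hS.lineCalc G h * hS.lineCalc G k := by
  have hc : ∀ u, hS.fn u * G = G * hS.fn u := fun u =>
    (hS.commute_fn (commute_square hG) u).eq.symm
  have hSX : ∀ X, S * X = G * (G * X) := fun X => by rw [← mul_assoc, hG]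
  rw [lineCalc, evenPart_mul, oddPart_mul, hS.fn_add (hh.1.mul hk.1)
    ((BddOnRay.inv_sq hS.pos).mul (hh.2.mul hk.2)), hS.fn_add (hh.1.mul hk.2) (hh.2.mul hk.1),
    hS.fn_mul hh.1 hk.1, hS.fn_mul (BddOnRay.inv_sq hS.pos) (hh.2.mul hk.2),
    hS.fn_mul hh.2 hk.2, hS.fn_mul hh.1 hk.2, hS.fn_mul hh.2 hk.1, hS.fn_inv_sq, lineCalc,
    lineCalc, hSX]
  simp only [mul_add, add_mul]
  rw [← mul_assoc (hS.fn (evenPart h)) G, hc, mul_assoc G (hS.fn (oddPart h)),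
    mul_assoc G (hS.fn (oddPart h)), ← mul_assoc (hS.fn (oddPart h)) G, hc]
  simp only [mul_assoc]
  abel

theorem lineCalc_smul (c : ℂ) (hh : GapAdmissible ε h) :
    hS.lineCalc G (fun s => c * h s) = c • hS.lineCalc G h := by
  have := hS.lineCalc_mul hG (GapAdmissible.const c) hh
  rw [lineCalc_const, smul_mul_assoc, one_mul] at this
  exact this

/-- Real functions give `J`-symmetric operators. -/
theorem kreinInner_lineCalc {J : K →L[ℂ] K} (hJS : Commute J S)
    (hJG : ∀ x y, kreinInner J (G x) y = kreinInner J x (G y)) (hh : GapAdmissible ε h)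
    (hr : ∀ s, star (h s) = h s) (x y : K) :
    kreinInner J (hS.lineCalc G h x) y = kreinInner J x (hS.lineCalc G h y) := by
  have h1 : star (evenPart h) = evenPart h := by
    ext s
    simp only [evenPart, Pi.star_apply, star_div₀, star_add, hr]
    simp
  have h2 : star (oddPart h) = oddPart h := by
    ext s
    simp only [oddPart, Pi.star_apply, star_div₀, star_mul', star_sub, hr]
    simp
  have hc : ∀ (u : ℝ → ℂ) (x : K), J (hS.fn u x) = hS.fn u (J x) := fun u x =>
    congrArg (fun T : K →L[ℂ] K => T x) (hS.commute_fn hJS u).eq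
  have hc' : ∀ (u : ℝ → ℂ) (x : K), G (hS.fn u x) = hS.fn u (G x) := fun u x =>
    congrArg (fun T : K →L[ℂ] K => T x) (hS.commute_fn (commute_square hG) u).eq
  have h3 : ∀ x y, kreinInner J (hS.fn (evenPart h) x) y =
      kreinInner J x (hS.fn (evenPart h) y) := fun x y => by
    rw [kreinInner, kreinInner, hc, hS.inner_fn_left hh.1, h1]
  have h4 : ∀ x y, kreinInner J (hS.fn (oddPart h) x) y =
      kreinInner J x (hS.fn (oddPart h) y) := fun x y => by
    rw [kreinInner, kreinInner, hc, hS.inner_fn_left hh.2, h2]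
  have ha : ∀ a b c, kreinInner J (a + b) c = kreinInner J a c + kreinInner J b c :=
    fun a b c => by simp [kreinInner]
  have hb : ∀ a b c, kreinInner J a (b + c) = kreinInner J a b + kreinInner J a c :=
    fun a b c => by simp [kreinInner]
  simp only [lineCalc, add_apply, mul_apply_eq_comp]
  rw [ha, hb, h3, hJG, h4, hc']

end Square

theorem tendsto_lineCalc {h : ℝ → ℂ} {l : ℕ → ℝ → ℂ} (hh : Measurable h)
    (hl : ∀ n, Measurable (l n)) {M N : ℝ} (hM : ∀ n (s : ℝ), ε ≤ |s| → ‖l n s‖ ≤ M)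
    (hN : ∀ n (s : ℝ), ε ≤ |s| → ‖s * l n s‖ ≤ N)
    (hlim : ∀ s : ℝ, ε ≤ |s| → Tendsto (fun n => l n s) atTop (𝓝 (h s))) (x : K) :
    Tendsto (fun n => hS.lineCalc G (l n) x) atTop (𝓝 (hS.lineCalc G h x)) := by
  have h1 : ∀ s, ε ≤ s → Tendsto (fun n => l n s) atTop (𝓝 (h s)) ∧
      Tendsto (fun n => l n (-s)) atTop (𝓝 (h (-s))) := fun s hs =>
    ⟨hlim _ (hs.trans (le_abs_self s)), hlim _ (by rw [abs_neg]; exact hs.trans (le_abs_self s))⟩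
  refine (hS.tendsto_fn (measurable_evenPart hh) (fun n => measurable_evenPart (hl n))
    (fun n s hs => norm_evenPart_le (hM n) hs) (fun s hs => ?_) x).add
    ((G.continuous.tendsto _).comp (hS.tendsto_fn (measurable_oddPart hh)
      (fun n => measurable_oddPart (hl n)) (fun n s hs => norm_oddPart_le (hN n) hs)
      (fun s hs => ?_) x))
  · exact ((h1 s hs).1.add (h1 s hs).2).div_const 2
  · exact (((h1 s hs).1.sub (h1 s hs).2).const_mul _).div_const 2

end IsInverseSquare

end GapCalculus

/-! ### Langer's spectral function as the calculus applied to indicators -/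

section SpectralFunction

/-- The indicator function of the real part of a subset of the extended line. -/
def realIndicator (Δ : Set (OnePoint ℝ)) : ℝ → ℂ :=
  Set.indicator {t : ℝ | (t : OnePoint ℝ) ∈ Δ} 1

theorem realIndicator_of_mem {Δ : Set (OnePoint ℝ)} {t : ℝ} (h : (t : OnePoint ℝ) ∈ Δ) :
    realIndicator Δ t = 1 := Set.indicator_of_mem (s := {t : ℝ | (t : OnePoint ℝ) ∈ Δ}) h _

theorem realIndicator_of_notMem {Δ : Set (OnePoint ℝ)} {t : ℝ} (h : (t : OnePoint ℝ) ∉ Δ) :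
    realIndicator Δ t = 0 := Set.indicator_of_notMem (s := {t : ℝ | (t : OnePoint ℝ) ∈ Δ}) h _

theorem coe_mem_toExt {I : Set ℝ} {t : ℝ} : (t : OnePoint ℝ) ∈ toExt I ↔ t ∈ I :=
  ⟨fun ⟨_, hs, h⟩ => OnePoint.coe_injective h ▸ hs, fun h => ⟨t, h, rfl⟩⟩

theorem infty_notMem_toExt {I : Set ℝ} : OnePoint.infty ∉ toExt I := fun ⟨_, _, h⟩ =>
  OnePoint.coe_ne_infty _ h

theorem norm_realIndicator_le (Δ : Set (OnePoint ℝ)) (t : ℝ) : ‖realIndicator Δ t‖ ≤ 1 := by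
  by_cases h : (t : OnePoint ℝ) ∈ Δ
  · simp [realIndicator_of_mem h]
  · simp [realIndicator_of_notMem h]

theorem realIndicator_inter (Δ Δ' : Set (OnePoint ℝ)) :
    realIndicator (Δ ∩ Δ') = realIndicator Δ * realIndicator Δ' := by
  ext t
  simp only [Pi.mul_apply]
  by_cases h : (t : OnePoint ℝ) ∈ Δ
  · by_cases h' : (t : OnePoint ℝ) ∈ Δ'
    · rw [realIndicator_of_mem h, realIndicator_of_mem h',
        realIndicator_of_mem (Set.mem_inter h h'), one_mul]
    · rw [realIndicator_of_notMem h', realIndicator_of_notMem fun h => h' h.2, mul_zero]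
  · rw [realIndicator_of_notMem h, realIndicator_of_notMem fun h' => h h'.1, zero_mul]

theorem realIndicator_union {Δ Δ' : Set (OnePoint ℝ)} (hd : Disjoint Δ Δ') :
    realIndicator (Δ ∪ Δ') = realIndicator Δ + realIndicator Δ' := by
  ext t
  simp only [Pi.add_apply]
  by_cases h : (t : OnePoint ℝ) ∈ Δ
  · rw [realIndicator_of_mem h, realIndicator_of_mem (Set.mem_union_left _ h),
      realIndicator_of_notMem (Set.disjoint_left.1 hd h), add_zero]
  · by_cases h' : (t : OnePoint ℝ) ∈ Δ'
    · rw [realIndicator_of_notMem h, realIndicator_of_mem h',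
        realIndicator_of_mem (Set.mem_union_right _ h'), zero_add]
    · rw [realIndicator_of_notMem h, realIndicator_of_notMem h', realIndicator_of_notMem, add_zero]
      rintro (h1 | h1)
      exacts [h h1, h' h1]

theorem IsAdmissibleInterval.measurable_realIndicator {I : Set ℝ} (hI : IsAdmissibleInterval I) :
    Measurable (realIndicator (toExt I)) := by
  refine Measurable.indicator measurable_one ?_
  have : {t : ℝ | (t : OnePoint ℝ) ∈ toExt I} = I := Set.ext fun t => coe_mem_toExt
  rw [this]
  exact hI.1.measurableSet

theorem IsAdmissibleInterval.exists_abs_le {I : Set ℝ} (hI : IsAdmissibleInterval I) :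
    ∃ r : ℝ, 0 ≤ r ∧ ∀ t ∈ I, |t| ≤ r := by
  obtain ⟨r, hr⟩ := isBounded_iff_forall_norm_le.1 hI.2.1
  exact ⟨max r 0, le_max_right _ _, fun t ht => (hr t ht).trans (le_max_left _ _)⟩

/-- The product of a locally bounded function and the indicator of a bounded interval is admissible. -/
theorem IsAdmissibleInterval.gapAdmissible_mul {I : Set ℝ} (hI : IsAdmissibleInterval I)
    {ε : ℝ} {k : ℝ → ℂ} (hk : Measurable k) {M : ℝ} (hM : ∀ t ∈ I, ε ≤ |t| → ‖k t‖ ≤ M) :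
    GapAdmissible ε (realIndicator (toExt I) * k) := by
  obtain ⟨r, hr0, hr⟩ := hI.exists_abs_le
  have h1 : ∀ s : ℝ, ε ≤ |s| → ‖(realIndicator (toExt I) * k) s‖ ≤ |M| := fun s hs => by
    by_cases h : s ∈ I
    · rw [Pi.mul_apply, realIndicator_of_mem (coe_mem_toExt.2 h), one_mul]
      exact (hM s h hs).trans (le_abs_self M)
    · rw [Pi.mul_apply, realIndicator_of_notMem fun h' => h (coe_mem_toExt.1 h'), zero_mul, norm_zero]
      exact abs_nonneg M
  refine GapAdmissible.of_bounded (hI.measurable_realIndicator.mul hk) h1 (N := r * |M|)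
    fun s hs => ?_
  by_cases h : s ∈ I
  · rw [norm_mul, Complex.norm_real, Real.norm_eq_abs]
    exact mul_le_mul (hr s h) (h1 s hs) (norm_nonneg _) hr0
  · rw [Pi.mul_apply, realIndicator_of_notMem fun h' => h (coe_mem_toExt.1 h'), zero_mul, mul_zero,
      norm_zero]
    positivity

theorem IsAdmissibleInterval.gapAdmissible {I : Set ℝ} (hI : IsAdmissibleInterval I) (ε : ℝ) :
    GapAdmissible ε (realIndicator (toExt I)) := by
  have := hI.gapAdmissible_mul (ε := ε) (k := 1) measurable_one (M := 1) (fun _ _ _ => by simp)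
  rwa [mul_one] at this

theorem realIndicator_compl (Δ : Set (OnePoint ℝ)) :
    realIndicator Δᶜ = (fun _ => 1) + (fun _ => -1) * realIndicator Δ := by
  ext t
  simp only [Pi.add_apply, Pi.mul_apply]
  by_cases h : (t : OnePoint ℝ) ∈ Δ
  · rw [realIndicator_of_mem h, realIndicator_of_notMem (Δ := Δᶜ) fun h' => h' h]
    norm_num
  · rw [realIndicator_of_notMem h, realIndicator_of_mem h]
    norm_num

theorem IsAdmissibleSet.gapAdmissible {Δ : Set (OnePoint ℝ)} (hΔ : IsAdmissibleSet Δ)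
    {ε : ℝ} (hε : 0 < ε) : GapAdmissible ε (realIndicator Δ) := by
  obtain ⟨I, hI, rfl | rfl⟩ := hΔ
  · exact hI.gapAdmissible ε
  · rw [realIndicator_compl]
    exact (GapAdmissible.const 1).add ((GapAdmissible.const (-1)).mul hε (hI.gapAdmissible ε))

theorem IsAdmissibleSet.measurable_realIndicator {Δ : Set (OnePoint ℝ)} (hΔ : IsAdmissibleSet Δ) :
    Measurable (realIndicator Δ) := by
  obtain ⟨I, hI, rfl | rfl⟩ := hΔ
  · exact hI.measurable_realIndicator
  · rw [realIndicator_compl]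
    exact measurable_const.add (measurable_const.mul hI.measurable_realIndicator)

theorem IsAdmissibleSet.exists_eq_toExt {Δ : Set (OnePoint ℝ)} (hΔ : IsAdmissibleSet Δ)
    {U : Set ℝ} (h : Δ ⊆ toExt U) : ∃ I, IsAdmissibleInterval I ∧ Δ = toExt I ∧ I ⊆ U := by
  obtain ⟨I, hI, rfl | rfl⟩ := hΔ
  · exact ⟨I, hI, rfl, fun t ht => coe_mem_toExt.1 (h (coe_mem_toExt.2 ht))⟩
  · exact absurd (h (show OnePoint.infty ∈ (toExt I)ᶜ from infty_notMem_toExt)) infty_notMem_toExt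

variable {K : Type*} [NormedAddCommGroup K] [InnerProductSpace ℂ K] [CompleteSpace K]
  {S : K →L[ℂ] K} {ε : ℝ} (hS : IsInverseSquare S ε) {G : K →L[ℂ] K}

/-- The spectral function of the operator `G⁻¹`, where `G ^ 2 = S`. -/
def IsInverseSquare.specFun (hS : IsInverseSquare S ε) (G : K →L[ℂ] K) (Δ : Set (OnePoint ℝ)) :
    K →L[ℂ] K := hS.lineCalc G (realIndicator Δ)

namespace IsInverseSquare

theorem specFun_empty : hS.specFun G ∅ = 0 := by
  have : realIndicator ∅ = fun _ => 0 := by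
    ext t
    exact realIndicator_of_notMem (Set.notMem_empty _)
  rw [specFun, this, lineCalc_const, zero_smul]

theorem specFun_univ : hS.specFun G Set.univ = 1 := by
  have : realIndicator Set.univ = fun _ => 1 := by
    ext t
    exact realIndicator_of_mem (Set.mem_univ _)
  rw [specFun, this, lineCalc_const, one_smul]

variable (hG : G * G = S)

include hG

theorem specFun_inter {Δ Δ' : Set (OnePoint ℝ)} (hΔ : IsAdmissibleSet Δ)
    (hΔ' : IsAdmissibleSet Δ') : hS.specFun G (Δ ∩ Δ') = hS.specFun G Δ * hS.specFun G Δ' := by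
  rw [specFun, realIndicator_inter, hS.lineCalc_mul hG (hΔ.gapAdmissible hS.pos)
    (hΔ'.gapAdmissible hS.pos)]
  rfl

theorem specFun_idem {Δ : Set (OnePoint ℝ)} (hΔ : IsAdmissibleSet Δ) (x : K) :
    hS.specFun G Δ (hS.specFun G Δ x) = hS.specFun G Δ x := by
  have := hS.specFun_inter hG hΔ hΔ
  rw [Set.inter_self] at this
  exact (congrArg (fun T : K →L[ℂ] K => T x) this).symm

/-- If `h s = s⁻¹ * h' s` on the spectrum, then the operator of `h` factors through `G`. -/
theorem lineCalc_eq_mul {h h' : ℝ → ℂ} (hh : GapAdmissible ε h) (hh' : GapAdmissible ε h')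
    (e : ∀ s : ℝ, ε ≤ |s| → s * h s = h' s) :
    hS.lineCalc G h = G * hS.lineCalc G h' ∧ hS.lineCalc G h = hS.lineCalc G h' * G := by
  have h0 : ∀ s : ℝ, ε ≤ |s| → h s = (s : ℂ)⁻¹ * h' s := fun s hs => by
    have : (s : ℂ) ≠ 0 := Complex.ofReal_ne_zero.2 (abs_pos.1 (hS.pos.trans_le hs))
    rw [← e s hs, inv_mul_cancel_left₀ this]
  have hi := GapAdmissible.inv hS.pos
  constructor
  · rw [hS.lineCalc_congr hh (hi.mul hS.pos hh') h0, hS.lineCalc_mul hG hi hh', lineCalc_inv]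
  · rw [hS.lineCalc_congr hh (hh'.mul hS.pos hi) fun s hs => (h0 s hs).trans (mul_comm _ _),
      hS.lineCalc_mul hG hh' hi, lineCalc_inv]

variable {T : K →ₗ.[ℂ] K} (hT : IsResolventOf T 0 G)

include hT

theorem map_lineCalc {h h' : ℝ → ℂ} (hh : GapAdmissible ε h) (hh' : GapAdmissible ε h')
    (e : ∀ s : ℝ, ε ≤ |s| → s * h s = h' s) (x : K) :
    ∃ hx : hS.lineCalc G h x ∈ T.domain, T ⟨hS.lineCalc G h x, hx⟩ = hS.lineCalc G h' x := by
  have key : ∀ v, v = G (hS.lineCalc G h' x) → ∃ hx : v ∈ T.domain, T ⟨v, hx⟩ =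
      hS.lineCalc G h' x := by
    rintro _ rfl
    exact ⟨hT.mem_domain _, hT.map_map_inv _ _⟩
  exact key _ (by rw [(hS.lineCalc_eq_mul hG hh hh' e).1]; rfl)

theorem specFun_bounded {I : Set ℝ} (hI : IsAdmissibleInterval I) :
    ∃ c : ℝ, ∀ x : K, ∃ h : hS.specFun G (toExt I) x ∈ T.domain,
      ‖T ⟨hS.specFun G (toExt I) x, h⟩‖ ≤ c * ‖hS.specFun G (toExt I) x‖ := by
  obtain ⟨r, hr0, hr⟩ := hI.exists_abs_le
  have h1 : GapAdmissible ε (realIndicator (toExt I) * fun s : ℝ => (s : ℂ)) :=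
    hI.gapAdmissible_mul Complex.measurable_ofReal (M := r) fun t ht _ => by
      rw [Complex.norm_real]; exact hr t ht
  refine ⟨‖hS.lineCalc G (realIndicator (toExt I) * fun s : ℝ => (s : ℂ))‖, fun x => ?_⟩
  obtain ⟨hx, hx'⟩ := hS.map_lineCalc hG hT (hI.gapAdmissible ε) h1 (fun s _ => mul_comm _ _)
    (hS.specFun G (toExt I) x)
  have h2 : hS.lineCalc G (realIndicator (toExt I)) (hS.specFun G (toExt I) x) =
    hS.specFun G (toExt I) x := hS.specFun_idem hG ⟨I, hI, Or.inl rfl⟩ x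
  have key : ∀ v, v = hS.specFun G (toExt I) x → ∀ hv : v ∈ T.domain,
      T ⟨v, hv⟩ = hS.lineCalc G (realIndicator (toExt I) * fun s : ℝ => (s : ℂ))
        (hS.specFun G (toExt I) x) → ∃ h : hS.specFun G (toExt I) x ∈ T.domain,
      ‖T ⟨hS.specFun G (toExt I) x, h⟩‖ ≤
        ‖hS.lineCalc G (realIndicator (toExt I) * fun s : ℝ => (s : ℂ))‖ *
          ‖hS.specFun G (toExt I) x‖ := by
    rintro _ rfl hv he
    refine ⟨hv, ?_⟩
    rw [he]
    exact ContinuousLinearMap.le_opNorm _ _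
  exact key _ h2 hx hx'

/-- For `z` off the closure of `Δ`, the function `χ_Δ(s) / (s - z)` is bounded and admissible, and
its operator restricts to the resolvent on the range of `χ_Δ(T)`. -/
theorem specFun_spectrum_part {Δ : Set (OnePoint ℝ)} (hΔ : IsAdmissibleSet Δ) :
    opSpectrum (partIn T (LinearMap.range (hS.specFun G Δ : K →ₗ[ℂ] K))) ⊆
      (fun t : ℝ => (t : ℂ)) '' closure {t : ℝ | (t : OnePoint ℝ) ∈ Δ} := by
  intro z hz
  by_contra hcl
  apply hz
  have hclosed : IsClosed ((fun t : ℝ => (t : ℂ)) '' closure {t : ℝ | (t : OnePoint ℝ) ∈ Δ}) :=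
    Complex.isometry_ofReal.isClosedEmbedding.isClosedMap _ isClosed_closure
  obtain ⟨d, hd, hball⟩ := Metric.isOpen_iff.1 hclosed.isOpen_compl z hcl
  have hdist : ∀ t : ℝ, (t : OnePoint ℝ) ∈ Δ → d ≤ ‖(t : ℂ) - z‖ := fun t ht => by
    by_contra! hlt
    exact hball (show (t : ℂ) ∈ Metric.ball z d by rwa [mem_ball_iff_norm])
      ⟨t, subset_closure ht, rfl⟩
  set F := hS.specFun G Δ
  set M := LinearMap.range (F : K →ₗ[ℂ] K)
  have hχ := hΔ.gapAdmissible hS.pos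
  let h : ℝ → ℂ := realIndicator Δ * fun s : ℝ => ((s : ℂ) - z)⁻¹
  have hm : Measurable h :=
    hΔ.measurable_realIndicator.mul (Complex.measurable_ofReal.sub_const z).inv
  have hb : ∀ s, ‖h s‖ ≤ d⁻¹ := fun s => by
    by_cases hs : (s : OnePoint ℝ) ∈ Δ
    · simp only [h, Pi.mul_apply, realIndicator_of_mem hs, one_mul, norm_inv]
      exact inv_anti₀ hd (hdist s hs)
    · simp only [h, Pi.mul_apply, realIndicator_of_notMem hs, zero_mul, norm_zero]
      positivity
  have he : ∀ s : ℝ, s * h s = realIndicator Δ s + z * h s := fun s => by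
    by_cases hs : (s : OnePoint ℝ) ∈ Δ
    · have : (s : ℂ) - z ≠ 0 := norm_pos_iff.1 (hd.trans_le (hdist s hs))
      simp only [h, Pi.mul_apply, realIndicator_of_mem hs, one_mul]
      field_simp
      ring
    · simp only [h, Pi.mul_apply, realIndicator_of_notMem hs, zero_mul, mul_zero, zero_add]
  have hh : GapAdmissible ε h := .of_bounded hm (fun s _ => hb s) (N := 1 + ‖z‖ * d⁻¹)
    fun s _ => by
      rw [he]
      refine (norm_add_le _ _).trans (add_le_add (norm_realIndicator_le _ _) ?_)
      rw [norm_mul]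
      exact mul_le_mul_of_nonneg_left (hb s) (norm_nonneg _)
  have hzh : GapAdmissible ε (fun s => z * h s) := (GapAdmissible.const z).mul hS.pos hh
  set R := hS.lineCalc G h
  have hR : hS.lineCalc G (realIndicator Δ + fun s => z * h s) = F + z • R := by
    rw [hS.lineCalc_add hχ hzh, hS.lineCalc_smul hG z hh]
    rfl
  have hFR : F * R = R := by
    have : realIndicator Δ * h = h := by
      simp only [h]
      rw [← mul_assoc, ← realIndicator_inter, Set.inter_self]
    have h2 := hS.lineCalc_mul hG hχ hh
    rw [this] at h2
    exact h2.symm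
  have hRM : ∀ x, R x ∈ M := fun x => ⟨R x, congrArg (fun T : K →L[ℂ] K => T x) hFR⟩
  have hFM : ∀ x ∈ M, F x = x := by
    rintro _ ⟨y, rfl⟩
    exact hS.specFun_idem hG hΔ y
  refine ⟨(R ∘L M.subtypeL).codRestrict M fun x => hRM _, fun x => ?_, fun x => ?_⟩
  · obtain ⟨hx, hx'⟩ := hS.map_lineCalc hG hT hh (hχ.add hzh) (fun s _ => he s) (x : K)
    rw [hR] at hx'
    have hx2 : T ⟨R x, hx⟩ = (x : K) + z • R x := by
      refine hx'.trans ?_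
      rw [add_apply, hFM x x.2]
      rfl
    refine ⟨⟨hx, ?_⟩, Subtype.ext ?_⟩
    · have : T ⟨R x, hx⟩ ∈ M := by
        rw [hx2]
        exact M.add_mem x.2 (M.smul_mem z (hRM _))
      exact this
    · exact sub_eq_iff_eq_add.2 hx2
  · obtain ⟨x, hx1, hx2⟩ := x
    refine Subtype.ext ?_
    change R (T ⟨x, hx1⟩ - z • (x : K)) = x
    have h1 : R (T ⟨x, hx1⟩) = F x + z • R x := by
      have h2 := (hS.lineCalc_eq_mul hG hh (hχ.add hzh) (fun s _ => he s)).2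
      rw [hR] at h2
      have h3 := congrArg (fun V : K →L[ℂ] K => V (T ⟨x, hx1⟩)) h2
      simp only [mul_apply_eq_comp, hT.inv_map] at h3
      exact h3
    rw [map_sub, map_smul, h1, hFM _ x.2, add_sub_cancel_right]

/-- With `u = √|s|`, let `P` and `Q` be the operators of `χ u` and `χ / u`, so that `P Q = Q P = F`.
On `I` one has `s = σ u²`, hence `T Q = σ P` and `[T Q x, Q x] = σ [P x, Q x] = σ [F x, F x]`.
Positivity of `T` at `Q x` gives the sign; `σ = 1` and `σ = -1` serve the two half-lines. -/
theorem re_kreinInner_specFun_pos {J : K →L[ℂ] K} (hJS : Commute J S)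
    (hJG : ∀ x y, kreinInner J (G x) y = kreinInner J x (G y)) (hJT : IsJPositive J T)
    {I : Set ℝ} (hI : IsAdmissibleInterval I) {σ : ℝ} (hσ : ∀ t ∈ I, t = σ * |t|) {x : K}
    (hx : hS.specFun G (toExt I) x ≠ 0) :
    0 < σ * (kreinInner J (hS.specFun G (toExt I) x) (hS.specFun G (toExt I) x)).re := by
  obtain ⟨r, hr0, hr⟩ := hI.exists_abs_le
  let u : ℝ → ℂ := fun s => ((√|s| : ℝ) : ℂ)
  have hu : Measurable u :=
    (Complex.continuous_ofReal.comp (Real.continuous_sqrt.comp continuous_abs)).measurable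
  have hu0 : ∀ s : ℝ, ε ≤ |s| → u s ≠ 0 := fun s hs =>
    Complex.ofReal_ne_zero.2 (Real.sqrt_pos.2 (hS.pos.trans_le hs)).ne'
  have h1 : GapAdmissible ε (realIndicator (toExt I) * u) :=
    hI.gapAdmissible_mul hu (M := √r) fun t ht _ => by
      rw [Complex.norm_real, Real.norm_of_nonneg (Real.sqrt_nonneg _)]
      exact Real.sqrt_le_sqrt (hr t ht)
  have h2 : GapAdmissible ε (realIndicator (toExt I) * fun s => (u s)⁻¹) :=
    hI.gapAdmissible_mul hu.inv (M := (√ε)⁻¹) fun t ht hs => by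
      rw [norm_inv, Complex.norm_real, Real.norm_of_nonneg (Real.sqrt_nonneg _)]
      exact inv_anti₀ (Real.sqrt_pos.2 hS.pos) (Real.sqrt_le_sqrt hs)
  have h3 : GapAdmissible ε (fun s => (σ : ℂ) * (realIndicator (toExt I) * u) s) :=
    (GapAdmissible.const σ).mul hS.pos h1
  have hχ := hI.gapAdmissible ε
  set F := hS.specFun G (toExt I)
  set P := hS.lineCalc G (realIndicator (toExt I) * u)
  set Q := hS.lineCalc G (realIndicator (toExt I) * fun s => (u s)⁻¹)
  have hQP : Q * P = F ∧ P * Q = F := by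
    have e : ∀ s : ℝ, ε ≤ |s| → (realIndicator (toExt I) s * (u s)⁻¹) *
        (realIndicator (toExt I) s * u s) = realIndicator (toExt I) s := fun s hs => by
      have h4 : realIndicator (toExt I) s * realIndicator (toExt I) s = realIndicator (toExt I) s := by
        rw [← Pi.mul_apply, ← realIndicator_inter, Set.inter_self]
      rw [mul_mul_mul_comm, h4, inv_mul_cancel₀ (hu0 s hs), mul_one]
    constructor
    · rw [← hS.lineCalc_mul hG h2 h1]
      exact hS.lineCalc_congr (h2.mul hS.pos h1) hχ e
    · rw [← hS.lineCalc_mul hG h1 h2]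
      exact hS.lineCalc_congr (h1.mul hS.pos h2) hχ fun s hs => (mul_comm _ _).trans (e s hs)
  obtain ⟨hd, hTQ⟩ := hS.map_lineCalc hG hT h2 h3 (fun s hs => by
    simp only [Pi.mul_apply]
    by_cases h : s ∈ I
    · rw [realIndicator_of_mem (coe_mem_toExt.2 h), one_mul, one_mul, ← div_eq_mul_inv,
        div_eq_iff (hu0 s hs), mul_assoc, ← Complex.ofReal_mul,
        Real.mul_self_sqrt (abs_nonneg s), ← Complex.ofReal_mul, ← hσ s h]
    · rw [realIndicator_of_notMem fun h' => h (coe_mem_toExt.1 h')]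
      simp) x
  rw [hS.lineCalc_smul hG _ h1] at hTQ
  have hg : Q x ≠ 0 := fun h0 => hx (by rw [← hQP.2, mul_apply_eq_comp, h0, map_zero])
  have hp := hJT ⟨Q x, hd⟩ hg
  have hQ : ∀ a b, kreinInner J (Q a) b = kreinInner J a (Q b) :=
    hS.kreinInner_lineCalc hG hJS hJG h2 fun s => by
      by_cases h : s ∈ I
      · simp [u, realIndicator_of_mem (coe_mem_toExt.2 h)]
      · simp [realIndicator_of_notMem fun h' => h (coe_mem_toExt.1 h')]
  have hF : ∀ a b, kreinInner J (F a) b = kreinInner J a (F b) :=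
    hS.kreinInner_lineCalc hG hJS hJG hχ fun s => by
      by_cases h : s ∈ I
      · simp [realIndicator_of_mem (coe_mem_toExt.2 h)]
      · simp [realIndicator_of_notMem fun h' => h (coe_mem_toExt.1 h')]
  have e1 : kreinInner J (T ⟨Q x, hd⟩) (Q x) = (σ : ℂ) * kreinInner J (F x) (F x) := by
    rw [hTQ, smul_apply]
    have e2 : kreinInner J (P x) (Q x) = kreinInner J (F x) (F x) := by
      rw [← hQ, ← mul_apply_eq_comp, hQP.1, ← hF, hS.specFun_idem hG ⟨I, hI, Or.inl rfl⟩]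
    rw [← e2, kreinInner, kreinInner, map_smul, inner_smul_left, Complex.conj_ofReal]
  have e3 : (kreinInner J (T ⟨Q x, hd⟩) (Q x)).re = σ * (kreinInner J (F x) (F x)).re := by
    rw [e1, Complex.re_ofReal_mul]
  rw [← e3]
  exact hp

/-- The spectral function has the properties of Langer's spectral function. -/
theorem isSpectralFunction {J : K →L[ℂ] K} (hJS : Commute J S)
    (hJG : ∀ x y, kreinInner J (G x) y = kreinInner J x (G y)) (hJT : IsJPositive J T) :
    IsSpectralFunction J T (hS.specFun G) where
  empty := hS.specFun_empty
  univ := hS.specFun_univ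
  inter := fun _ _ hΔ hΔ' _ => hS.specFun_inter hG hΔ hΔ'
  union := fun Δ Δ' hΔ hΔ' _ hd => by
    rw [specFun, realIndicator_union hd,
      hS.lineCalc_add (hΔ.gapAdmissible hS.pos) (hΔ'.gapAdmissible hS.pos)]
    rfl
  symm := fun Δ hΔ => hS.kreinInner_lineCalc hG hJS hJG (hΔ.gapAdmissible hS.pos) fun s => by
    by_cases h : (s : OnePoint ℝ) ∈ Δ
    · simp [realIndicator_of_mem h]
    · simp [realIndicator_of_notMem h]
  pos := fun Δ hΔ hsub x hx => by
    obtain ⟨I, hI, rfl, hI'⟩ := hΔ.exists_eq_toExt hsub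
    have := hS.re_kreinInner_specFun_pos hG hT hJS hJG hJT hI (σ := 1) (fun t ht => by
      rw [one_mul, abs_of_pos (hI' ht)]) hx
    rwa [one_mul] at this
  neg := fun Δ hΔ hsub x hx => by
    obtain ⟨I, hI, rfl, hI'⟩ := hΔ.exists_eq_toExt hsub
    have := hS.re_kreinInner_specFun_pos hG hT hJS hJG hJT hI (σ := -1) (fun t ht => by
      rw [abs_of_neg (hI' ht)]; ring) hx
    linarith
  bicommutant := fun Δ _ B hB => by
    -- Commuting with the resolvent at 0, which is `G`, is enough.
    have h := hB 0 ⟨G, hT⟩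
    rw [hT.eq_opResolvent] at h
    refine hS.commute_lineCalc ?_ h _
    rw [← hG]
    exact h.mul_right h
  spectrum_part := fun Δ hΔ => hS.specFun_spectrum_part hG hT hΔ
  bounded := fun I hI => hS.specFun_bounded hG hT hI
  continuous := fun I hI hanti hempty _ x => by
    obtain ⟨r, hr0, hr⟩ := (hI 0).exists_abs_le
    have h0 : (0 : K) = hS.lineCalc G (fun _ => 0) x := by
      rw [lineCalc_const, zero_smul, zero_apply]
    rw [h0]
    refine hS.tendsto_lineCalc measurable_const (fun n => (hI n).measurable_realIndicator) (M := 1)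
      (N := r) (fun n s _ => norm_realIndicator_le _ s) (fun n s _ => ?_) (fun s _ => ?_) x
    · by_cases h : s ∈ I n
      · rw [realIndicator_of_mem (coe_mem_toExt.2 h), mul_one, Complex.norm_real]
        exact hr s (hanti (Nat.zero_le n) h)
      · rw [realIndicator_of_notMem fun h' => h (coe_mem_toExt.1 h'), mul_zero, norm_zero]
        exact hr0
    · have hs : s ∉ ⋂ n, I n := by rw [hempty]; exact Set.notMem_empty s
      obtain ⟨N, hN⟩ := not_forall.1 (fun h => hs (Set.mem_iInter.2 h))
      refine tendsto_const_nhds.congr' ?_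
      filter_upwards [eventually_ge_atTop N] with n hn
      exact (realIndicator_of_notMem fun h' => hN (hanti hn (coe_mem_toExt.1 h'))).symm

end IsInverseSquare

end SpectralFunction

/-! ### Behaviour of the spectral function near infinity -/

section Infinity

theorem isAdmissibleInterval_of_subset {I C : Set ℝ} (h : I.OrdConnected)
    (hb : Bornology.IsBounded I) (hC : IsClosed C) (hIC : I ⊆ C) (h0 : (0 : ℝ) ∉ C) :
    IsAdmissibleInterval I :=
  ⟨h, hb, fun h' => h0 (closure_minimal hIC hC (frontier_subset_closure h'))⟩

variable {K : Type*} [NormedAddCommGroup K] [InnerProductSpace ℂ K] [CompleteSpace K]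
  {S : K →L[ℂ] K} {ε : ℝ} (hS : IsInverseSquare S ε) {G : K →L[ℂ] K}

/-- The bounded intervals `(ρ, ρ + n)` (for `σ = 1`) and `(-ρ - n, -ρ)` (for `σ = -1`). -/
def signedInterval (σ ρ : ℝ) (n : ℕ) : Set ℝ := {t | ρ < σ * t ∧ σ * t < ρ + n}

theorem isAdmissibleInterval_signedInterval {σ ρ : ℝ} (hσ : σ = 1 ∨ σ = -1) (hρ : 0 < ρ) (n : ℕ) :
    IsAdmissibleInterval (signedInterval σ ρ n) := by
  have hcont : Continuous fun t : ℝ => σ * t := by fun_prop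
  refine isAdmissibleInterval_of_subset (C := {t | ρ ≤ σ * t}) ?_ ?_
    (isClosed_le continuous_const hcont) (fun t ht => ht.1.le) (by simp [hρ])
  · refine ⟨fun a ha b hb c hc => ?_⟩
    obtain ⟨ha1, ha2⟩ := ha
    obtain ⟨hb1, hb2⟩ := hb
    rcases hσ with rfl | rfl
    · exact ⟨by linarith [hc.1], by linarith [hc.2]⟩
    · exact ⟨by linarith [hc.2], by linarith [hc.1]⟩
  · refine isBounded_iff_forall_norm_le.2 ⟨ρ + n, fun t ht => ?_⟩
    obtain ⟨h1, h2⟩ := ht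
    rw [Real.norm_eq_abs, abs_le]
    rcases hσ with rfl | rfl
    · constructor <;> linarith
    · constructor <;> linarith

namespace IsInverseSquare

/-- If `S` is not surjective, then the spectral function does not vanish near `+∞` and `-∞`. -/
theorem exists_specFun_ne_zero (hsurj : ¬ Function.Surjective S) {τ : K →L[ℂ] K}
    (hτ : ∀ x, τ (τ x) = x) (hτS : Commute τ S) (hτG : ∀ x, τ (G x) = -G (τ x))
    {σ ρ : ℝ} (hσ : σ = 1 ∨ σ = -1) (hρ : 0 < ρ) :
    ∃ n x, hS.specFun G (toExt (signedInterval σ ρ n)) x ≠ 0 := by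
  by_contra! hzero
  have hI := fun n => isAdmissibleInterval_signedInterval hσ hρ n
  set e : ℕ → ℝ → ℂ := fun n => evenPart (realIndicator (toExt (signedInterval σ ρ n)))
  -- Conjugation by `τ` changes the sign of the `G` term only, so adding the two vanishing
  -- expressions isolates the even part.
  have he : ∀ n, hS.fn (e n) = 0 := fun n => by
    ext x
    have h1 := hzero n x
    have h2 := congrArg τ (hzero n (τ x))
    have hc : ∀ u y, τ (hS.fn u y) = hS.fn u (τ y) := fun u y =>
      congrArg (fun V : K →L[ℂ] K => V y) (hS.commute_fn hτS u).eq
    simp only [specFun, lineCalc, add_apply, mul_apply_eq_comp] at h1 h2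
    rw [map_add, hτG, hc, hc, hτ, map_zero] at h2
    have h3 : (2 : ℂ) • hS.fn (e n) x = 0 := by
      rw [two_smul]
      nth_rewrite 1 [eq_neg_of_add_eq_zero_left h1]
      nth_rewrite 1 [eq_neg_of_add_eq_zero_left h2]
      rw [neg_neg, neg_add_cancel]
    exact (smul_eq_zero.1 h3).resolve_left two_ne_zero
  -- On the ray, `ψ` is the pointwise limit of the even parts, so its operator vanishes. Since `s⁻²
  -- k + 2 ψ = 1` there, `S k(S) = 1`, a right inverse of `S`.
  let ψ : ℝ → ℂ := fun s => if s ≤ ρ then 0 else 1 / 2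
  let k : ℝ → ℂ := fun s => if s ≤ ρ then (s : ℂ) ^ 2 else 0
  have hψ : BddOnRay ε ψ := by
    refine ⟨Measurable.ite measurableSet_Iic measurable_const measurable_const, 1, fun s _ => ?_⟩
    simp only [ψ]
    split_ifs <;> norm_num
  have hk : BddOnRay ε k := by
    refine ⟨Measurable.ite measurableSet_Iic (Complex.measurable_ofReal.pow_const 2)
      measurable_const, ρ ^ 2, fun s hs => ?_⟩
    simp only [k]
    split_ifs with h
    · rw [norm_pow, Complex.norm_real, Real.norm_of_nonneg (hS.pos.le.trans hs)]
      have := hS.pos.le.trans hs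
      gcongr
    · rw [norm_zero]
      positivity
  have h1 : hS.fn ψ = 0 := by
    ext x
    have hlim := hS.tendsto_fn (k := ψ) (l := e) hψ.1
      (fun n => measurable_evenPart (hI n).measurable_realIndicator) (M := 1)
      (fun n s hs => norm_evenPart_le (fun s _ => norm_realIndicator_le _ s) hs) (fun s hs => ?_) x
    · simp only [he, zero_apply] at hlim
      exact tendsto_nhds_unique hlim tendsto_const_nhds
    · have hs0 : 0 < s := hS.pos.trans_le hs
      by_cases hsρ : s ≤ ρ
      · refine tendsto_const_nhds.congr fun n => ?_
        simp only [ψ, e, evenPart, if_pos hsρ]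
        rw [realIndicator_of_notMem, realIndicator_of_notMem, add_zero, zero_div]
        · rw [coe_mem_toExt]
          rintro ⟨h, -⟩
          rcases hσ with rfl | rfl <;> linarith
        · rw [coe_mem_toExt]
          rintro ⟨h, -⟩
          rcases hσ with rfl | rfl <;> linarith
      · obtain ⟨N, hN⟩ := exists_nat_gt (s - ρ)
        refine tendsto_const_nhds.congr' ?_
        filter_upwards [eventually_ge_atTop N] with n hn
        have hn' : (N : ℝ) ≤ n := Nat.cast_le.2 hn
        simp only [ψ, e, evenPart, if_neg hsρ]
        rw [not_le] at hsρ
        rcases hσ with rfl | rfl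
        · rw [realIndicator_of_mem, realIndicator_of_notMem, add_zero]
          · rw [coe_mem_toExt]
            rintro ⟨h, -⟩
            linarith
          · rw [coe_mem_toExt]
            constructor <;> linarith
        · rw [realIndicator_of_notMem, realIndicator_of_mem, zero_add]
          · rw [coe_mem_toExt]
            constructor <;> linarith
          · rw [coe_mem_toExt]
            rintro ⟨h, -⟩
            linarith
  have h2 : hS.fn ((fun s : ℝ => ((s : ℂ) ^ 2)⁻¹) * k + (ψ + ψ)) = hS.fn (fun _ => 1) := by
    refine hS.fn_congr (((BddOnRay.inv_sq hS.pos).mul hk).add (hψ.add hψ)) (.const 1)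
      fun s hs => ?_
    have hs0 : (s : ℂ) ^ 2 ≠ 0 :=
      pow_ne_zero 2 (Complex.ofReal_ne_zero.2 (hS.pos.trans_le hs).ne')
    simp only [Pi.add_apply, Pi.mul_apply, ψ, k]
    split_ifs
    · rw [inv_mul_cancel₀ hs0, add_zero, add_zero]
    · norm_num
  rw [hS.fn_add ((BddOnRay.inv_sq hS.pos).mul hk) (hψ.add hψ), hS.fn_add hψ hψ, h1,
    hS.fn_mul (BddOnRay.inv_sq hS.pos) hk, hS.fn_inv_sq, fn_const, one_smul, add_zero,
    add_zero] at h2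
  exact hsurj fun x => ⟨hS.fn k x, congrArg (fun V : K →L[ℂ] K => V x) h2⟩

/-- The positive square root of `S`. -/
theorem fn_inv_mul_self : hS.fn (fun s => (s : ℂ)⁻¹) * hS.fn (fun s => (s : ℂ)⁻¹) = S := by
  have hb : BddOnRay ε (fun s => (s : ℂ)⁻¹) := by
    refine ⟨Complex.measurable_ofReal.inv, ε⁻¹, fun s hs => ?_⟩
    have := hS.pos
    rw [norm_inv, Complex.norm_real, Real.norm_of_nonneg (this.le.trans hs)]
    gcongr
  rw [← hS.fn_mul hb hb]
  refine Eq.trans ?_ hS.fn_inv_sq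
  congr 1
  ext s
  rw [Pi.mul_apply, sq, mul_inv]

/-- If `E([ε, t])` converges strongly, then the range of `S ^ (1 / 2)` lies in that of `G`. -/
theorem exists_eq_of_tendsto (hG : G * G = S) {x y : K}
    (h : Tendsto (fun t : ℝ => hS.specFun G (toExt (Set.Icc ε t)) x) atTop (𝓝 y)) :
    ∃ w, hS.fn (fun s => (s : ℂ)⁻¹) x = G w := by
  have hε := hS.pos
  have hI : ∀ t, IsAdmissibleInterval (Set.Icc ε t) := fun t =>
    isAdmissibleInterval_of_subset Set.ordConnected_Icc (Metric.isBounded_Icc _ _) isClosed_Icc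
      subset_rfl fun h => absurd h.1 (not_le.2 hε)
  have hneg : ∀ (s : ℝ), ε ≤ s → ∀ t, realIndicator (toExt (Set.Icc ε t)) (-s) = 0 :=
    fun s hs t => realIndicator_of_notMem fun h' => by
      have := (coe_mem_toExt.1 h').1
      linarith
  have hev : ∀ (s : ℝ), ε ≤ s → ∀ᶠ n : ℕ in atTop, realIndicator (toExt (Set.Icc ε n)) s = 1 :=
    fun s hs => by
      obtain ⟨N, hN⟩ := exists_nat_ge s
      filter_upwards [eventually_ge_atTop N] with n hn
      exact realIndicator_of_mem (coe_mem_toExt.2 ⟨hs, hN.trans (Nat.cast_le.2 hn)⟩)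
  have hn := h.comp (tendsto_natCast_atTop_atTop (R := ℝ))
  set χ : ℕ → ℝ → ℂ := fun n => realIndicator (toExt (Set.Icc ε n))
  have hχ : ∀ n, GapAdmissible ε (χ n) := fun n => (hI n).gapAdmissible ε
  have h1 := hS.tendsto_fn (k := fun _ => 1 / 2) (l := fun n => evenPart (χ n)) measurable_const
    (fun n => (hχ n).1.1) (M := 1)
    (fun n s hs => norm_evenPart_le (fun s _ => norm_realIndicator_le _ s) hs) (fun s hs => by
      refine tendsto_const_nhds.congr' ?_
      filter_upwards [hev s hs] with n h
      simp only [evenPart, χ, h, hneg s hs, add_zero]) x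
  have hinv := BddOnRay.inv_sq hε
  -- The odd parts `s χ_n(s) / 2` are unbounded in `n`; multiplied by `s⁻²` they stay below `ε⁻¹`
  -- and tend to `s⁻¹ / 2`.
  have h2 := hS.tendsto_fn (k := fun s => (1 / 2 : ℂ) * (s : ℂ)⁻¹)
    (l := fun n => (fun s : ℝ => ((s : ℂ) ^ 2)⁻¹) * oddPart (χ n))
    (measurable_const.mul Complex.measurable_ofReal.inv)
    (fun n => hinv.1.mul (hχ n).2.1) (M := ε⁻¹) (fun n s hs => by
      have hs0 : 0 < s := hε.trans_le hs
      have hc : (s : ℂ) ≠ 0 := Complex.ofReal_ne_zero.2 hs0.ne'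
      have e : (((fun s : ℝ => ((s : ℂ) ^ 2)⁻¹) * oddPart (χ n)) s) =
          (s : ℂ)⁻¹ * (χ n s / 2) := by
        simp only [Pi.mul_apply, oddPart, χ, hneg s hs, sub_zero]
        field_simp
      rw [e, norm_mul, norm_inv, Complex.norm_real, Real.norm_of_nonneg hs0.le]
      have h3 : ‖χ n s / 2‖ ≤ 1 := by
        rw [norm_div, Complex.norm_ofNat]
        have := norm_realIndicator_le (toExt (Set.Icc ε n)) s
        linarith [show ‖χ n s‖ ≤ 1 from this]
      have h4 : s⁻¹ ≤ ε⁻¹ := inv_anti₀ hε hs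
      calc s⁻¹ * ‖χ n s / 2‖ ≤ ε⁻¹ * 1 :=
            mul_le_mul h4 h3 (norm_nonneg _) (inv_nonneg.2 hε.le)
        _ = ε⁻¹ := mul_one _) (fun s hs => by
      refine tendsto_const_nhds.congr' ?_
      filter_upwards [hev s hs] with n h
      have hc : (s : ℂ) ≠ 0 := Complex.ofReal_ne_zero.2 (hε.trans_le hs).ne'
      simp only [Pi.mul_apply, oddPart, χ, hneg s hs, h, sub_zero]
      field_simp) x
  -- The even parts tend strongly to `1/2`, so convergence of the spectral function forces
  -- convergence of the `G` term alone.
  have h3 : Tendsto (fun n => G (hS.fn (oddPart (χ n)) x)) atTop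
      (𝓝 (y - hS.fn (fun _ => 1 / 2) x)) := by
    refine (hn.sub h1).congr fun n => ?_
    simp only [Function.comp_apply, specFun, lineCalc, add_apply, mul_apply_eq_comp]
    exact add_sub_cancel_left _ _
  have h4 := (G.continuous.tendsto _).comp h3
  have h5 : ∀ n, G (G (hS.fn (oddPart (χ n)) x)) =
      hS.fn ((fun s : ℝ => ((s : ℂ) ^ 2)⁻¹) * oddPart (χ n)) x := fun n => by
    rw [hS.fn_mul hinv (hχ n).2, hS.fn_inv_sq, mul_apply_eq_comp]
    exact congrArg (fun V : K →L[ℂ] K => V _) hG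
  have h6 := tendsto_nhds_unique h4 (h2.congr fun n => (h5 n).symm)
  have hb : BddOnRay ε (fun s => (s : ℂ)⁻¹) := by
    refine ⟨Complex.measurable_ofReal.inv, ε⁻¹, fun s hs => ?_⟩
    rw [norm_inv, Complex.norm_real, Real.norm_of_nonneg (hε.le.trans hs)]
    gcongr
  rw [hS.fn_smul _ hb, smul_apply] at h6
  -- Applying `G` to the limit gives `G (y - x/2) = S^(1/2) x / 2`, hence the witness `2 y - x`.
  refine ⟨(2 : ℂ) • (y - hS.fn (fun _ => 1 / 2) x), ?_⟩
  rw [map_smul, h6, smul_smul]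
  norm_num

end IsInverseSquare

end Infinity

/-! ### Infinity is a singular critical point of the block operator -/

section BlockInfinity

variable {H : Type*} [NormedAddCommGroup H] [InnerProductSpace ℂ H] [CompleteSpace H]
  {A : H →ₗ.[ℂ] H} (hA : IsSelfAdjoint A) {ε : ℝ} (hε : 0 < ε)
  (hpos : ∀ x : A.domain, ε ^ 2 * ‖(x : H)‖ ^ 2 ≤ (inner ℂ (A x) (x : H)).re)

/-- The inverse of the block operator in terms of the inverse `B` of `A`. -/
def blockInv (B : H →L[ℂ] H) : WithLp 2 (H × H) →L[ℂ] WithLp 2 (H × H) :=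
  blockOp 0 (Complex.I • B) (-Complex.I • 1) 0

theorem blockInv_fst (B : H →L[ℂ] H) (f : WithLp 2 (H × H)) :
    (blockInv B f).fst = Complex.I • B f.snd := by
  simp [blockInv]

theorem blockInv_snd (B : H →L[ℂ] H) (f : WithLp 2 (H × H)) :
    (blockInv B f).snd = -Complex.I • f.fst := by
  simp [blockInv]

theorem isResolventOf_blockInv {B : H →L[ℂ] H} (hB : IsResolventOf A 0 B) :
    IsResolventOf (blockL A) 0 (blockInv B) := by
  have h := isResolventOf_blockL (A := A) (z := 0) (R := B) (by simpa using hB)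
  have e : blockOp ((0 : ℂ) • B) (Complex.I • B) (-Complex.I • (1 + (0 : ℂ) ^ 2 • B))
      ((0 : ℂ) • B) = blockInv B := by
    simp [blockInv]
  rwa [e] at h

theorem blockInv_mul_self (B : H →L[ℂ] H) : blockInv B * blockInv B = blockOp B 0 0 B := by
  ext f
  refine prod_ext ?_ ?_
  · rw [mul_apply_eq_comp, blockInv_fst, blockInv_snd, map_smul, smul_smul]
    simp
  · rw [mul_apply_eq_comp, blockInv_snd, blockInv_fst, smul_smul]
    simp

theorem kreinInner_blockInv {B : H →L[ℂ] H} (hB : ∀ x y, inner ℂ (B x) y = inner ℂ x (B y))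
    (f g : WithLp 2 (H × H)) :
    kreinInner (blockJ H) (blockInv B f) g = kreinInner (blockJ H) f (blockInv B g) := by
  simp only [kreinInner, prod_inner, blockJ_fst, blockJ_snd, blockInv_fst, blockInv_snd,
    inner_smul_left, inner_smul_right, hB]
  simp only [map_neg, Complex.conj_I]
  ring

theorem commute_blockOp_diag (B : H →L[ℂ] H) {T : WithLp 2 (H × H) →L[ℂ] WithLp 2 (H × H)}
    (h1 : ∀ f, (T (blockOp B 0 0 B f)).fst = B (T f).fst)
    (h2 : ∀ f, (T (blockOp B 0 0 B f)).snd = B (T f).snd) : Commute T (blockOp B 0 0 B) := by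
  ext f
  refine prod_ext ?_ ?_
  · rw [mul_apply_eq_comp, mul_apply_eq_comp, h1]
    simp
  · rw [mul_apply_eq_comp, mul_apply_eq_comp, h2]
    simp

include hA hε hpos

theorem isInverseSquare_block :
    IsInverseSquare (blockOp (opResolvent A 0) 0 0 (opResolvent A 0)) ε := by
  set B := opResolvent A 0
  have hs := inner_inv_left hA hε hpos
  refine ⟨hε, fun f g => ?_, fun f => ?_, ?_, fun f g h => ?_⟩
  · simp only [prod_inner, blockOp_fst, blockOp_snd, zero_apply, add_zero, zero_add]
    rw [hs, hs]
  · simp only [prod_inner, blockOp_fst, blockOp_snd, zero_apply, add_zero, zero_add]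
    rw [Complex.add_re]
    exact add_nonneg (re_inner_inv_nonneg hA hε hpos _) (re_inner_inv_nonneg hA hε hpos _)
  · refine ContinuousLinearMap.opNorm_le_bound _ (by positivity) fun f => ?_
    have hb : ∀ x, ‖B x‖ ≤ (ε ^ 2)⁻¹ * ‖x‖ := fun x =>
      (B.le_opNorm x).trans (mul_le_mul_of_nonneg_right (norm_inv_le hA hε hpos) (norm_nonneg _))
    refine le_of_sq_le_sq ?_ (by positivity)
    rw [mul_pow, WithLp.prod_norm_sq_eq_of_L2, WithLp.prod_norm_sq_eq_of_L2 f, mul_add, ← mul_pow,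
      ← mul_pow]
    simp only [blockOp_fst, blockOp_snd, zero_apply, add_zero, zero_add]
    exact add_le_add (pow_le_pow_left₀ (norm_nonneg _) (hb _) 2)
      (pow_le_pow_left₀ (norm_nonneg _) (hb _) 2)
  · have hinj := (isResolventOf_zero hA hε hpos).inv_injective
    have h1 := congrArg WithLp.fst h
    have h2 := congrArg WithLp.snd h
    simp only [blockOp_fst, blockOp_snd, zero_apply, add_zero, zero_add] at h1 h2
    exact prod_ext (hinj h1) (hinj h2)

theorem not_surjective_block (hunb : ¬ IsBoundedPMap A) :
    ¬ Function.Surjective (blockOp (opResolvent A 0) 0 0 (opResolvent A 0)) := fun h =>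
  not_surjective_inv hA hε hpos hunb fun x => by
    obtain ⟨f, hf⟩ := h (WithLp.toLp 2 (x, 0))
    have := congrArg WithLp.fst hf
    simp only [blockOp_fst, zero_apply, add_zero] at this
    exact ⟨f.fst, this⟩

/-- Infinity is a singular critical point of the block operator. -/
theorem hasSingularCriticalPointAtInfinity_blockL (hunb : ¬ IsBoundedPMap A) :
    HasSingularCriticalPointAtInfinity (blockJ H) (blockL A) := by
  have hB := isResolventOf_zero hA hε hpos
  have hS := isInverseSquare_block hA hε hpos
  have hns := not_surjective_block hA hε hpos hunb
  have hT := isResolventOf_blockInv hB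
  have hG := blockInv_mul_self (opResolvent A 0)
  set B := opResolvent A 0
  have hJS : Commute (blockJ H) (blockOp B 0 0 B) := by
    refine commute_blockOp_diag B (fun f => ?_) fun f => ?_ <;> simp
  have hF := hS.isSpectralFunction hG hT hJS (kreinInner_blockInv (inner_inv_left hA hε hpos))
    (isJPositive_blockL hε hpos)
  refine ⟨isFundamentalSymmetry_blockJ, isJSelfAdjoint_blockL hA hε hpos, isJNonneg_blockL hε hpos,
    ⟨0, hT.mem_opResolventSet⟩, hS.specFun (blockInv B), hF, ?_, ?_⟩
  · rintro Δ hΔ hinf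
    obtain ⟨I, hI, rfl | rfl⟩ := id hΔ
    · exact absurd hinf infty_notMem_toExt
    -- Since `I` lies in `[-r, r]`, intervals beyond `r + 1` on either side avoid both `I` and 0.
    obtain ⟨r, hr0, hr⟩ := hI.exists_abs_le
    -- The reflection `diag(1, -1)` anticommutes with the off-diagonal `blockInv B` and commutes
    -- with `B ⊕ B`: it implements `s ↦ -s`.
    let τ : WithLp 2 (H × H) →L[ℂ] WithLp 2 (H × H) := blockOp 1 0 0 (-1)
    have key : ∀ σ : ℝ, σ = 1 ∨ σ = -1 → ∃ n x,
        hS.specFun (blockInv B) (toExt (signedInterval σ (r + 1) n)) x ≠ 0 ∧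
        hS.specFun (blockInv B) (toExt I)ᶜ
          (hS.specFun (blockInv B) (toExt (signedInterval σ (r + 1) n)) x) =
        hS.specFun (blockInv B) (toExt (signedInterval σ (r + 1) n)) x := fun σ hσ => by
      obtain ⟨n, x, hx⟩ := hS.exists_specFun_ne_zero (G := blockInv B) hns (τ := τ)
        (fun f => prod_ext (by simp [τ]) (by simp [τ]))
        (commute_blockOp_diag B (fun f => by simp [τ]) fun f => by simp [τ])
        (fun f => prod_ext (by simp [τ, blockInv_fst]) (by simp [τ, blockInv_snd])) hσ
        (show 0 < r + 1 by positivity)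
      have hadm : IsAdmissibleSet (toExt (signedInterval σ (r + 1) n)) :=
        ⟨_, isAdmissibleInterval_signedInterval hσ (by positivity) n, Or.inl rfl⟩
      have hsub : (toExt I)ᶜ ∩ toExt (signedInterval σ (r + 1) n) =
          toExt (signedInterval σ (r + 1) n) := by
        refine Set.inter_eq_self_of_subset_right ?_
        rintro _ ⟨t, ht, rfl⟩ hmem
        have h1 := hr t (coe_mem_toExt.1 hmem)
        have h2 := abs_le.1 h1
        have h3 := ht.1
        rcases hσ with rfl | rfl <;> linarith
      refine ⟨n, x, hx, ?_⟩
      have h1 := hS.specFun_inter hG hΔ hadm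
      rw [hsub] at h1
      exact (congrArg (fun V : WithLp 2 (H × H) →L[ℂ] WithLp 2 (H × H) => V x) h1).symm
    constructor
    · obtain ⟨n, x, hx, hx'⟩ := key 1 (Or.inl rfl)
      refine ⟨hS.specFun (blockInv B) (toExt (signedInterval 1 (r + 1) n)) x, ?_⟩
      rw [hx']
      refine hF.pos _ ⟨_, isAdmissibleInterval_signedInterval (Or.inl rfl) (by positivity) n,
        Or.inl rfl⟩ (Set.image_mono fun t ht => ?_) x hx
      have := ht.1
      exact show 0 < t by linarith
    · obtain ⟨n, x, hx, hx'⟩ := key (-1) (Or.inr rfl)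
      refine ⟨hS.specFun (blockInv B) (toExt (signedInterval (-1) (r + 1) n)) x, ?_⟩
      rw [hx']
      refine hF.neg _ ⟨_, isAdmissibleInterval_signedInterval (Or.inr rfl) (by positivity) n,
        Or.inl rfl⟩ (Set.image_mono fun t ht => ?_) x hx
      have := ht.1
      exact show t < 0 by linarith
  -- The limits at `+∞` alone, with `a = ε`, already lead to a contradiction.
  · rintro ⟨hlim, -⟩
    set W := hS.fn (fun s => (s : ℂ)⁻¹)
    have hWW : W * W = blockOp B 0 0 B := hS.fn_inv_mul_self
    have hfst : ∀ f, ∃ u, (W f).fst = B u := fun f => by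
      obtain ⟨y, hy⟩ := hlim ε hε f
      obtain ⟨w, hw⟩ := hS.exists_eq_of_tendsto hG hy
      refine ⟨Complex.I • w.snd, ?_⟩
      rw [map_smul, ← blockInv_fst, ← hw]
    -- The coordinate swap commutes with `B ⊕ B`, hence with its square root `W`, and carries the
    -- conclusion on first components to second ones.
    let P : WithLp 2 (H × H) →L[ℂ] WithLp 2 (H × H) := blockOp 0 1 1 0
    have hP : Commute P (blockOp B 0 0 B) :=
      commute_blockOp_diag B (fun f => by simp [P]) fun f => by simp [P]
    have hsnd : ∀ f, ∃ u, (W f).snd = B u := fun f => by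
      obtain ⟨u, hu⟩ := hfst (P f)
      refine ⟨u, ?_⟩
      have h1 : P (W f) = W (P f) :=
        congrArg (fun V : WithLp 2 (H × H) →L[ℂ] WithLp 2 (H × H) => V f) (hS.commute_fn hP _).eq
      rw [← hu, ← h1]
      simp [P]
    have happ : ∀ f, W (W f) = blockOp B 0 0 B f := fun f =>
      congrArg (fun V : WithLp 2 (H × H) →L[ℂ] WithLp 2 (H × H) => V f) hWW
    have hinj : Function.Injective W := fun f g h => hS.inj (by rw [← happ, ← happ, h])
    -- Both components of `W f` lie in the range of `B`, so `W f = W² (u, v)`, and injectivity of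
    -- `W` gives `f = W (u, v)`.
    have hsurj : Function.Surjective W := fun f => by
      obtain ⟨u, hu⟩ := hfst f
      obtain ⟨v, hv⟩ := hsnd f
      refine ⟨WithLp.toLp 2 (u, v), hinj ?_⟩
      rw [happ]
      exact prod_ext (by simp [hu]) (by simp [hv])
    exact hns fun f => by
      obtain ⟨g, rfl⟩ := hsurj f
      obtain ⟨g, rfl⟩ := hsurj g
      exact ⟨g, (happ g).symm⟩

end BlockInfinity

end

/-! ### The main theorem -/

theorem mainTheorem3 {H : Type*} [NormedAddCommGroup H] [InnerProductSpace ℂ H] [CompleteSpace H]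
    (A : H →ₗ.[ℂ] H) (hA : IsSelfAdjoint A) (hunb : ¬ IsBoundedPMap A)
    (ε : ℝ) (hε : 0 < ε)
    (hpos : ∀ x : A.domain, ε ^ 2 * ‖(x : H)‖ ^ 2 ≤ (inner ℂ (A x) (x : H)).re) :
    -- `L` is `J`-self-adjoint and `J`-positive
    IsFundamentalSymmetry (blockJ H) ∧
    IsJSelfAdjoint (blockJ H) (blockL A) ∧
    IsJPositive (blockJ H) (blockL A) ∧
    -- `T(z) = I - z² A⁻¹ = (A - z²) A⁻¹`
    (0 : ℂ) ∈ opResolventSet A ∧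
    (∀ (z : ℂ) (x : H), ∃ h : opResolvent A 0 x ∈ A.domain,
      schurT A z x = A ⟨opResolvent A 0 x, h⟩ - z ^ 2 • opResolvent A 0 x) ∧
    -- the spectrum of `L`
    opSpectrum (blockL A) = {z : ℂ | ∃ t : ℝ, z = (t : ℂ) ∧ ((t : ℂ)) ^ 2 ∈ opSpectrum A} ∧
    opSpectrum (blockL A) ⊆ {z : ℂ | ∃ t : ℝ, z = (t : ℂ) ∧ t ∉ Set.Ioo (-ε) ε} ∧
    -- `T(z)⁻¹ = A (A - z²)⁻¹` is bounded with norm at least `1`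
    (∀ z ∈ opResolventSet (blockL A),
      IsUnit (schurT A z) ∧ z ^ 2 ∈ opResolventSet A ∧
      (∀ x : H, ∃ h : opResolvent A (z ^ 2) x ∈ A.domain,
        Ring.inverse (schurT A z) x = A ⟨opResolvent A (z ^ 2) x, h⟩) ∧
      1 ≤ ‖Ring.inverse (schurT A z)‖) ∧
    -- consequences
    ¬ LinearResolventGrowth (blockL A) ∧
    ¬ IsSimilarToSelfAdjoint (blockL A) ∧
    HasSingularCriticalPointAtInfinity (blockJ H) (blockL A) := by
  refine ⟨isFundamentalSymmetry_blockJ, isJSelfAdjoint_blockL hA hε hpos,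
    isJPositive_blockL hε hpos, zero_mem_opResolventSet hA hε hpos, schurT_apply hA hε hpos,
    opSpectrum_blockL hA hε hpos, fun z hz => ?_, fun z hz => ?_,
    not_linearResolventGrowth_blockL hA hε hpos hunb, fun h => ?_,
    hasSingularCriticalPointAtInfinity_blockL hA hε hpos hunb⟩
  · obtain ⟨t, ht, -, ht'⟩ := exists_real_of_mem_opSpectrum_blockL hA hε hpos hz
    exact ⟨t, ht, ht'⟩
  · have hu := isUnit_schurT hA hε hpos hz
    have hR := isResolventOf_opResolvent A _ (sq_mem_of_mem_blockL hz)
    refine ⟨hu, sq_mem_of_mem_blockL hz, fun x => ⟨hR.mem_domain x, ?_⟩,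
      one_le_norm_inverse hA hε hpos hunb hu⟩
    rw [hR.apply_apply, inverse_schurT hA hε hpos hz]
    rfl
  · exact not_linearResolventGrowth_blockL hA hε hpos hunb (linearResolventGrowth_of_isSimilar h
      fun _ hz => mem_opResolventSet_blockL_of_im_ne hA hε hpos hz)
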